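/- Consider simple graphs $G$ on the vertex set $\{0,\dots,n-1\}$, $n \ge 1$, with maximum degree $\Delta$. In the vertex arrival model, the vertices arrive one by one in an arbitrary order, and upon the arrival of a vertex all of its edges to the previously arrived vertices are revealed (in an arbitrary order). A randomized streaming algorithm makes a single pass over this input, knows $n$ and $\Delta$ in advance, may toss fair coins at any time, and reports the colors of the edges on a write-only output tape that does not count as space; all its working memory counts as space. The graph and the arrival order do not depend on the coin tosses. **Theorem.** For every $c \in \mathbb{N}$ there are a randomized streaming algorithm and constants $C, k$ such that, for every $n \ge 1$, every $n$-vertex graph $G$ and every vertex arrival order of $G$, the algorithm uses at most $C\, n\, b(n)^k = \widetilde{O}(n)$ bits of space (up to a constant factor depending only on the algorithm), where $b(n)$ is the number of binary digits of $n$, whatever its coin tosses are, and with probability at least $1 - n^{-c}$ it reports every edge of $G$ exactly once together with a color, these colors forming a proper edge coloring of $G$ with the $C\Delta$ colors $0, \dots, C\Delta - 1$. -/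

import Mathlib

namespace WStream

/-! ### The input: vertex-arrival streams -/

/-- Items of the input stream of a graph on the vertex set `Fin n`. -/
inductive Token (n : ℕ) where
  /-- vertex `v` arrives -/
  | arrive (v : Fin n)
  /-- the vertex that arrived last has an edge to the vertex `u` -/
  | nbr (u : Fin n)
  /-- end of the stream -/
  | eos

/-- The number under which a token is presented to an algorithm. -/
def Token.toNat {n : ℕ} : Token n → ℕ
  | .eos => 0
  | .arrive v => 2 * (v : ℕ) + 1
  | .nbr u => 2 * (u : ℕ) + 2

/-- The vertices arrive in the order `π 0, π 1, …`; together with a vertex `v`, all entries of the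
list `back v` (the other endpoints of the edges from `v` to earlier vertices) arrive. -/
def vertexStream {n : ℕ} (π : Equiv.Perm (Fin n)) (back : Fin n → List (Fin n)) :
    List (Token n) :=
  (List.ofFn fun i : Fin n => Token.arrive (π i) :: (back (π i)).map Token.nbr).flatten
    ++ [Token.eos]

/-- `back v` lists, without repetition and in an arbitrary order, exactly those neighbours of `v`
in `G` that precede `v` in the arrival order `π`. -/
def IsBackLists {n : ℕ} (G : SimpleGraph (Fin n)) (π : Equiv.Perm (Fin n))
    (back : Fin n → List (Fin n)) : Prop :=
  ∀ v, (back v).Nodup ∧ ∀ u, u ∈ back v ↔ G.Adj v u ∧ π.symm u < π.symm v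

/-! ### The output: reported edge colorings -/

/-- A record `(u, v, c)` on the output tape says "the edge `uv` has color `c`". -/
abbrev Record := ℕ × ℕ × ℕ

/-- The list `L` of records reports a proper edge coloring of `G` with the `K` colors
`0, …, K - 1`: there is a proper edge coloring `χ` of `G` (a vertex coloring of the line graph)
such that every record gives an edge of `G` with its color under `χ`, and every edge of `G` is
reported exactly once. -/
def ReportsEdgeColoring {n : ℕ} (G : SimpleGraph (Fin n)) (K : ℕ) (L : List Record) : Prop :=
  ∃ χ : G.lineGraph.Coloring (Fin K),
    (∀ r ∈ L, ∃ (u v : Fin n) (h : G.Adj u v),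
      r = ((u : ℕ), (v : ℕ), ((χ ⟨s(u, v), h⟩ : Fin K) : ℕ))) ∧
    ∀ u v : Fin n, G.Adj u v →
      L.countP (fun r => decide (s(r.1, r.2.1) = s((u : ℕ), (v : ℕ)))) = 1

/-! ### Space-bounded randomized one-pass streaming algorithms with a write-only output tape -/

/-- Evaluation of the program `p` on the input `x` in a working memory of `S` bits (up to a constant
factor depending only on `p`). Programs are Mathlib's codes for partial recursive functions.
`Nat.Partrec.Code.evaln k p x` succeeds only if no number `≥ k` is ever used as an argument of a
subprogram during the evaluation (and no primitive recursion or search runs through more than `k`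
rounds). So for `k = 2 ^ S` the evaluation only ever handles numbers of `O(S)` bits, and only
constantly many of them have to be kept at the same time: at each node of the program the current
arguments, a loop counter and the last intermediate value (a primitive recursion is carried out
as a loop from below). -/
def evalSpace (S : ℕ) (p : Nat.Partrec.Code) (x : ℕ) : Option ℕ :=
  Nat.Partrec.Code.evaln (2 ^ S) p x

/-- A randomized single-pass streaming algorithm: four programs, which do not depend on the
input. The algorithm knows the number `n` of vertices and the maximum degree `Δ`. -/
structure Algorithm where
  /-- on input `(n, Δ)`: the number of random bits drawn for each token -/
  coins : Nat.Partrec.Code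
  /-- the new content of the memory after a token -/
  update : Nat.Partrec.Code
  /-- the number of rounds of the print loop at a token -/
  rounds : Nat.Partrec.Code
  /-- what is printed in a given round of the print loop (a record, or nothing) -/
  print : Nat.Partrec.Code

/-- `0` stands for "print nothing", and `q + 1` for the record (triple) coded by `q`. -/
def decodeRecord : ℕ → Option Record
  | 0 => none
  | q + 1 => some (q.unpair.1, q.unpair.2.unpair.1, q.unpair.2.unpair.2)

namespace Algorithm

/-- What the programs can access when a token is processed: `n`, `Δ`, the content `m` of the
memory, the token `t`, and fresh random bits `ρ`. -/
def view (n Δ m t ρ : ℕ) : ℕ :=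
  Nat.pair n (Nat.pair Δ (Nat.pair m (Nat.pair t ρ)))

/-- Processing of one token: the new content of the memory and the records that are printed
(in this order); `none` if the space bound is violated in any of the evaluations. -/
def process (A : Algorithm) (S n Δ m t ρ : ℕ) : Option (ℕ × List Record) := do
  let x := view n Δ m t ρ
  let k ← evalSpace S A.rounds x
  let out ← (List.range k).mapM fun i => evalSpace S A.print (Nat.pair x i)
  let m' ← evalSpace S A.update x
  return (m', out.filterMap decodeRecord)

/-- Processing of a list of tokens, each with its random bits, from the memory content `m` on: all
the records that are printed; `none` if the space bound is violated at any point. -/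
def exec (A : Algorithm) (S n Δ : ℕ) : ℕ → List (ℕ × ℕ) → Option (List Record)
  | _, [] => some []
  | m, (t, ρ) :: rest => do
    let (m', out) ← A.process S n Δ m t ρ
    let out' ← A.exec S n Δ m' rest
    return out ++ out'

/-- The run of the algorithm, starting with empty memory, on a stream; the random bits drawn at the
`i`-th token are the binary digits of `ω i`. -/
def run (A : Algorithm) (S Δ : ℕ) {n : ℕ} (stream : List (Token n)) {R : ℕ}
    (ω : Fin stream.length → Fin (2 ^ R)) : Option (List Record) :=
  A.exec S n Δ 0 (List.ofFn fun i => ((stream.get i).toNat, (ω i : ℕ)))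

/-- The probability, over independent uniform random bits (`R` for each token), that the
algorithm reports a proper edge coloring of `G` with `K` colors. -/
noncomputable def successProb (A : Algorithm) (S Δ K : ℕ) {n : ℕ} (G : SimpleGraph (Fin n))
    (stream : List (Token n)) (R : ℕ) : ℝ :=
  (Set.ncard {ω : Fin stream.length → Fin (2 ^ R) |
      ∃ L, A.run S Δ stream ω = some L ∧ ReportsEdgeColoring G K L} : ℝ) /
    (Fintype.card (Fin stream.length → Fin (2 ^ R)) : ℝ)

end Algorithm

end WStream

/-!
The algorithm is an online greedy coloring in which every vertex remembers only a polylogarithmic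
number of bits.

Let `h` be a large multiple of `log n`. If `Δ < h`, every vertex can afford to remember the set of
the colors at it, and the greedy algorithm succeeds with `2 * Δ + 1` colors.

If `Δ ≥ h`, the `O(Δ)` colors are arranged in `O(Δ / h)` blocks of `16 * h` positions. At its
arrival, a vertex draws a random *shift*, that is, a block, and a random *polarity* for each
position, which reserves the position, in all blocks, either for its edges to later vertices or for
its edges to earlier ones. For its edges to later vertices it visits the blocks cyclically, starting
with its shift, and passes on to the next block after every `h` such edges; it remembers only the
positions that it has used in the current block. The number of blocks is so large that no block is
visited twice. The edges from a new vertex `v` to earlier vertices `u` are colored greedily: the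
edge `uv` receives a color in the current block of `u`, at a position that has the right polarities
at `u` and at `v`, has not been used by `u` in this block, and gives a color that `v` has not
received before. All colors at `v` from this step have to be remembered, but only until the next
vertex arrives.

The coloring is proper as long as a position can always be found (`Invariant.color_ne`): two edges
to later vertices differ in the block or in the position, two edges to earlier vertices
are compared directly, and an edge to a later vertex differs from an edge to an earlier one by the
polarity.

A position is found for `uv` if more than `2 * h` positions have the right polarities and if
at most `h` earlier neighbours of `v` are in the same block as `u` (`Invariant.exists_free`): at
most `h` positions are blocked at each end. The numbers of edges to later vertices do not depend on
the random bits, so the blocks of the neighbours of `v` are independent and uniformly distributed.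
Hence both conditions fail only with probability `2 ^ (-h)`, by exponential moments
(`card_few_positions`, `card_overload_le`), and a union bound finishes the argument
(`card_not_lucky_le`).

To run this within the given model, the memory is stored in numbers as arrays of digits, and the
step of the algorithm has to be carried out by codes whose evaluation handles only numbers of
`O(n log n)` bits. `SpaceComputable` collects the functions for which this is possible. It is closed
under composition and under primitive recursion with bounded values; since
running time is of no concern, arithmetic and search may be implemented in the most naive way.
-/

namespace WStream

open Nat.Partrec (Code)
open Nat.Partrec.Code (evaln evaln_mono evaln_bound)

/-! ### Functions computable in space linear in a given number of bits -/

/-- The family `f` of numbers is bounded by a polynomial in `s`; in other words, the numbers `f i`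
have `O(log (s i))` bits. -/
def PolyBdd {ι : Type} (s f : ι → ℕ) : Prop := ∃ e, ∀ i, f i ≤ (s i + 2) ^ e

/-- A single program computes `f i` from `x i` for all `i`, in such a way that the bound on the
numbers that `evaln` handles is polynomial in `s i`; in other words, in space `O(log (s i))`. -/
def SpaceComputable {ι : Type} (s x f : ι → ℕ) : Prop :=
  PolyBdd s f ∧ ∃ (p : Code) (e : ℕ), ∀ i, evaln ((s i + 2) ^ e) p (x i) = some (f i)

theorem evaln_of_le {k k' x y : ℕ} {p : Code} (hk : k ≤ k') (h : evaln k p x = some y) :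
    evaln k' p x = some y :=
  evaln_mono hk h

theorem add_two_pow_le (s : ℕ) {e e' : ℕ} (h : e ≤ e') : (s + 2) ^ e ≤ (s + 2) ^ e' :=
  Nat.pow_le_pow_right (by omega) h

theorem evaln_comp {k x y z : ℕ} {p q : Code} (hq : evaln k q x = some y)
    (hp : evaln k p y = some z) : evaln k (.comp p q) x = some z := by
  have hx := evaln_bound hq
  obtain ⟨k, rfl⟩ : ∃ k', k = k' + 1 := ⟨k - 1, by omega⟩
  simp [evaln, hp, hq, Nat.lt_succ_iff.1 hx]

theorem evaln_pair {k x y z : ℕ} {p q : Code} (hp : evaln k p x = some y)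
    (hq : evaln k q x = some z) : evaln k (.pair p q) x = some (Nat.pair y z) := by
  have hx := evaln_bound hq
  obtain ⟨k, rfl⟩ : ∃ k', k = k' + 1 := ⟨k - 1, by omega⟩
  simp [evaln, hp, hq, Nat.lt_succ_iff.1 hx, Seq.seq]

namespace PolyBdd

variable {ι : Type} {s f g : ι → ℕ}

theorem mono (hg : PolyBdd s g) (h : ∀ i, f i ≤ g i) : PolyBdd s f := by
  obtain ⟨e, he⟩ := hg
  exact ⟨e, fun i => (h i).trans (he i)⟩

theorem const (c : ℕ) : PolyBdd s fun _ => c :=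
  ⟨c, fun i => (Nat.lt_two_pow_self (n := c)).le.trans (Nat.pow_le_pow_left (by omega) c)⟩

theorem add (hf : PolyBdd s f) (hg : PolyBdd s g) : PolyBdd s fun i => f i + g i := by
  obtain ⟨e, he⟩ := hf
  obtain ⟨e', he'⟩ := hg
  refine ⟨e + e' + 1, fun i => ?_⟩
  have h1 := (he i).trans (add_two_pow_le (s i) (show e ≤ e + e' by omega))
  have h2 := (he' i).trans (add_two_pow_le (s i) (show e' ≤ e + e' by omega))
  calc f i + g i ≤ (s i + 2) ^ (e + e') * 2 := by omega
    _ ≤ (s i + 2) ^ (e + e') * (s i + 2) := Nat.mul_le_mul_left _ (by omega)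
    _ = _ := (pow_succ _ _).symm

theorem mul (hf : PolyBdd s f) (hg : PolyBdd s g) : PolyBdd s fun i => f i * g i := by
  obtain ⟨e, he⟩ := hf
  obtain ⟨e', he'⟩ := hg
  refine ⟨e + e', fun i => ?_⟩
  rw [pow_add]
  exact Nat.mul_le_mul (he i) (he' i)

theorem pair (hf : PolyBdd s f) (hg : PolyBdd s g) : PolyBdd s fun i => Nat.pair (f i) (g i) := by
  have h := (hf.add hg).add (const (s := s) 1)
  refine (h.mul h).mono fun i => ?_
  have := (Nat.pair_lt_max_add_one_sq (f i) (g i)).le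
  rw [← pow_two]
  exact this.trans (Nat.pow_le_pow_left (by omega) 2)

theorem comp {κ : Type} (φ : κ → ι) (hf : PolyBdd s f) : PolyBdd (s ∘ φ) (f ∘ φ) := by
  obtain ⟨e, he⟩ := hf
  exact ⟨e, fun i => he (φ i)⟩

end PolyBdd

namespace SpaceComputable

variable {ι : Type} {s x f g : ι → ℕ}

theorem bdd (hf : SpaceComputable s x f) : PolyBdd s f := hf.1

theorem bdd_input (hf : SpaceComputable s x f) : PolyBdd s x := by
  obtain ⟨-, p, e, h⟩ := hf
  exact ⟨e, fun i => (evaln_bound (h i)).le⟩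

theorem congr (hf : SpaceComputable s x f) (h : ∀ i, f i = g i) : SpaceComputable s x g := by
  obtain rfl : f = g := funext h
  exact hf

/-- A code and an exponent that may be enlarged at will. -/
theorem exists_code (hf : SpaceComputable s x f) :
    ∃ (p : Code) (e : ℕ), ∀ i k, (s i + 2) ^ e ≤ k → evaln k p (x i) = some (f i) := by
  obtain ⟨-, p, e, h⟩ := hf
  exact ⟨p, e, fun i k hk => evaln_of_le hk (h i)⟩

theorem of_exists_code (hf : PolyBdd s f)
    (h : ∃ (p : Code) (e : ℕ), ∀ i k, (s i + 2) ^ e ≤ k → evaln k p (x i) = some (f i)) :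
    SpaceComputable s x f := by
  obtain ⟨p, e, h⟩ := h
  exact ⟨hf, p, e, fun i => h i _ le_rfl⟩

theorem comp (hg : SpaceComputable s f g) (hf : SpaceComputable s x f) :
    SpaceComputable s x g := by
  obtain ⟨p, e, hp⟩ := hg.exists_code
  obtain ⟨q, e', hq⟩ := hf.exists_code
  exact of_exists_code hg.bdd ⟨.comp p q, e + e', fun i k hk =>
    evaln_comp (hq i k ((add_two_pow_le _ (by omega)).trans hk))
      (hp i k ((add_two_pow_le _ (by omega)).trans hk))⟩

theorem pair (hf : SpaceComputable s x f) (hg : SpaceComputable s x g) :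
    SpaceComputable s x fun i => Nat.pair (f i) (g i) := by
  obtain ⟨p, e, hp⟩ := hf.exists_code
  obtain ⟨q, e', hq⟩ := hg.exists_code
  exact of_exists_code (hf.bdd.pair hg.bdd) ⟨.pair p q, e + e', fun i k hk =>
    evaln_pair (hp i k ((add_two_pow_le _ (by omega)).trans hk))
      (hq i k ((add_two_pow_le _ (by omega)).trans hk))⟩

/-- A program that needs no more than its input to be below the bound. -/
theorem of_basic (hx : PolyBdd s x) (hf : PolyBdd s f) (p : Code)
    (h : ∀ i k, x i ≤ k → evaln (k + 1) p (x i) = some (f i)) : SpaceComputable s x f := by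
  refine of_exists_code hf ?_
  obtain ⟨e, he⟩ := hx
  refine ⟨p, e + 1, fun i k hk => ?_⟩
  have hlt : (s i + 2) ^ e < (s i + 2) ^ (e + 1) := Nat.pow_lt_pow_right (by omega) (by omega)
  have hxk : x i < k := (he i).trans_lt (hlt.trans_le hk)
  obtain ⟨k, rfl⟩ : ∃ k', k = k' + 1 := ⟨k - 1, by omega⟩
  exact h i k (by omega)

theorem fst_input (hx : PolyBdd s x) : SpaceComputable s x fun i => (x i).unpair.1 :=
  of_basic hx (hx.mono fun _ => Nat.unpair_left_le _) .left fun i k hk => by simp [evaln, hk]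

theorem snd_input (hx : PolyBdd s x) : SpaceComputable s x fun i => (x i).unpair.2 :=
  of_basic hx (hx.mono fun _ => Nat.unpair_right_le _) .right fun i k hk => by simp [evaln, hk]

theorem fst (hf : SpaceComputable s x f) : SpaceComputable s x fun i => (f i).unpair.1 :=
  (fst_input hf.bdd).comp hf

theorem snd (hf : SpaceComputable s x f) : SpaceComputable s x fun i => (f i).unpair.2 :=
  (snd_input hf.bdd).comp hf

theorem input (hx : PolyBdd s x) : SpaceComputable s x x :=
  ((fst_input hx).pair (snd_input hx)).congr fun i => Nat.pair_unpair (x i)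

theorem succ (hf : SpaceComputable s x f) : SpaceComputable s x fun i => f i + 1 := by
  refine comp (f := f) ?_ hf
  exact of_basic hf.bdd (hf.bdd.add (.const 1)) .succ fun i k hk => by simp [evaln, hk]

theorem const (hx : PolyBdd s x) (c : ℕ) : SpaceComputable s x fun _ => c := by
  induction c with
  | zero => exact of_basic hx (.const 0) .zero fun i k hk => by simp [evaln, hk]
  | succ c ih => exact ih.succ

theorem reindex {κ : Type} (φ : κ → ι) (hf : SpaceComputable s x f) :
    SpaceComputable (s ∘ φ) (x ∘ φ) (f ∘ φ) := by
  obtain ⟨hb, p, e, h⟩ := hf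
  exact ⟨hb.comp φ, p, e, fun i => h (φ i)⟩

/-- Bounded primitive recursion: a recursion all of whose values stay polynomially bounded. -/
theorem prec {N : ι → ℕ} {v : ι → ℕ → ℕ} (hN : SpaceComputable s x N)
    (h0 : SpaceComputable s x fun i => v i 0)
    (hs : SpaceComputable (ι := {p : ι × ℕ // p.2 < N p.1}) (fun p => s p.1.1)
      (fun p => Nat.pair (x p.1.1) (Nat.pair p.1.2 (v p.1.1 p.1.2)))
      (fun p => v p.1.1 (p.1.2 + 1))) :
    SpaceComputable s x fun i => v i (N i) := by
  have hx := h0.bdd_input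
  refine of_exists_code ?_ ?_
  · obtain ⟨e, he⟩ := h0.bdd
    obtain ⟨e', he'⟩ := hs.bdd
    refine ⟨e + e', fun i => ?_⟩
    change v i (N i) ≤ _
    rcases hn : N i with _ | j
    · exact (he i).trans (add_two_pow_le _ (Nat.le_add_right e e'))
    · exact (he' ⟨(i, j), by simp [hn]⟩).trans (add_two_pow_le _ (Nat.le_add_left e' e))
  obtain ⟨p0, e0, hp0⟩ := h0.exists_code
  obtain ⟨p1, e1, hp1⟩ := hs.exists_code
  obtain ⟨pN, eN, hpN⟩ := ((input hx).pair hN).exists_code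
  obtain ⟨eB, hB⟩ := (hx.pair hN.bdd).add (.const 1)
  obtain ⟨eM, hM⟩ := hN.bdd
  set e := e0 + e1 + eN + eB + eM with he
  have key : ∀ i j, j ≤ N i →
      evaln ((s i + 2) ^ e + j) (.prec p0 p1) (Nat.pair (x i) j) = some (v i j) := by
    intro i j
    induction j with
    | zero =>
      intro _
      have hlt : Nat.pair (x i) 0 < (s i + 2) ^ e := by
        have h1 : Nat.pair (x i) (N i) + 1 ≤ (s i + 2) ^ eB := hB i
        have h2 : (s i + 2) ^ eB ≤ (s i + 2) ^ e := add_two_pow_le _ (by omega)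
        have h3 : Nat.pair (x i) 0 ≤ Nat.pair (x i) (N i) := by
          rcases Nat.eq_zero_or_pos (N i) with h | h
          · rw [h]
          · exact (Nat.pair_lt_pair_right _ h).le
        omega
      have h1 := hp0 i _ (add_two_pow_le (s i) (show e0 ≤ e by omega))
      obtain ⟨k, hk⟩ : ∃ k', (s i + 2) ^ e = k' + 1 := ⟨(s i + 2) ^ e - 1, by omega⟩
      rw [hk] at hlt h1
      rw [hk]
      simp [evaln, h1, Nat.lt_succ_iff.1 hlt]
    | succ j ih =>
      intro hj
      have h1 := ih (by omega)
      have hlt : Nat.pair (x i) (j + 1) < (s i + 2) ^ e := by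
        have h1 : Nat.pair (x i) (N i) + 1 ≤ (s i + 2) ^ eB := hB i
        have h2 : (s i + 2) ^ eB ≤ (s i + 2) ^ e := add_two_pow_le _ (by omega)
        have h3 : Nat.pair (x i) (j + 1) ≤ Nat.pair (x i) (N i) := by
          rcases hj.eq_or_lt with h | h
          · rw [h]
          · exact (Nat.pair_lt_pair_right _ h).le
        omega
      have h2 := hp1 ⟨(i, j), by simpa using hj⟩ ((s i + 2) ^ e + j + 1)
        ((add_two_pow_le (s i) (show e1 ≤ e by omega)).trans (by omega))
      have h3 : Nat.pair (x i) (j + 1) ≤ (s i + 2) ^ e + j := by omega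
      rw [← add_assoc]
      simp only at h2
      simp [evaln, h1, h2, h3]
  -- `evaln` lowers its bound by one in every round, so `N i` is added to the bound.
  refine ⟨.comp (.prec p0 p1) pN, e + 1, fun i k hk => ?_⟩
  have hk' : (s i + 2) ^ e + N i ≤ k := by
    have h1 := hM i
    have h2 : (s i + 2) ^ eM ≤ (s i + 2) ^ e := add_two_pow_le _ (by omega)
    have h3 : (s i + 2) ^ e * 2 ≤ (s i + 2) ^ e * (s i + 2) := Nat.mul_le_mul_left _ (by omega)
    rw [← pow_succ] at h3
    omega
  exact evaln_comp (hpN i k ((add_two_pow_le _ (by omega)).trans hk))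
    (evaln_of_le hk' (key i (N i) le_rfl))

/-! ### Arithmetic in linear space -/

/-- A recursion with step function `F`, where the bound on the values is given separately; `F` has
access to the input, the round and the last value. -/
theorem rec_of_bdd {N : ι → ℕ} {v : ι → ℕ → ℕ} (hN : SpaceComputable s x N)
    (h0 : SpaceComputable s x fun i => v i 0)
    (hb : PolyBdd (ι := {p : ι × ℕ // p.2 < N p.1}) (fun p => s p.1.1) (fun p => v p.1.1 p.1.2))
    (hs : ∀ {y : {p : ι × ℕ // p.2 < N p.1} → ℕ},
      (∀ {f : ι → ℕ}, SpaceComputable s x f →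
        SpaceComputable (fun p => s p.1.1) y (fun p => f p.1.1)) →
      SpaceComputable (fun p => s p.1.1) y (fun p => p.1.2) →
      SpaceComputable (fun p => s p.1.1) y (fun p => v p.1.1 p.1.2) →
      SpaceComputable (fun p => s p.1.1) y (fun p => v p.1.1 (p.1.2 + 1))) :
    SpaceComputable s x fun i => v i (N i) := by
  have hx := h0.bdd_input
  let φ : {p : ι × ℕ // p.2 < N p.1} → ι := fun p => p.1.1
  have hy : PolyBdd (ι := {p : ι × ℕ // p.2 < N p.1}) (fun p => s p.1.1)
      (fun p => Nat.pair (x p.1.1) (Nat.pair p.1.2 (v p.1.1 p.1.2))) :=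
    (hx.comp φ).pair (((hN.bdd.comp φ).mono fun p => p.2.le).pair hb)
  have hin := input hy
  refine prec hN h0 (hs (fun {f} hf => ?_) ?_ ?_)
  · exact (hf.reindex φ).comp (hin.fst.congr fun p => by simp [φ])
  · exact hin.snd.fst.congr fun p => by simp
  · exact hin.snd.snd.congr fun p => by simp

theorem add (hf : SpaceComputable s x f) (hg : SpaceComputable s x g) :
    SpaceComputable s x fun i => f i + g i :=
  rec_of_bdd (v := fun i j => f i + j) hg hf
    ((hf.bdd.add hg.bdd).comp (fun p : {p : ι × ℕ // p.2 < g p.1} => p.1.1) |>.mono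
      fun p => Nat.add_le_add_left p.2.le _)
    fun _ _ hv => hv.succ

theorem pred (hf : SpaceComputable s x f) : SpaceComputable s x fun i => f i - 1 :=
  rec_of_bdd (v := fun _ j => j - 1) hf (const hf.bdd_input 0)
    ((hf.bdd.comp (fun p : {p : ι × ℕ // p.2 < f p.1} => p.1.1)).mono
      fun p => (Nat.sub_le _ _).trans p.2.le)
    fun _ hj _ => hj

theorem sub (hf : SpaceComputable s x f) (hg : SpaceComputable s x g) :
    SpaceComputable s x fun i => f i - g i :=
  rec_of_bdd (v := fun i j => f i - j) hg hf
    ((hf.bdd.comp (fun p : {p : ι × ℕ // p.2 < g p.1} => p.1.1)).mono fun _ => Nat.sub_le _ _)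
    fun _ _ hv => hv.pred

theorem mul (hf : SpaceComputable s x f) (hg : SpaceComputable s x g) :
    SpaceComputable s x fun i => f i * g i :=
  rec_of_bdd (v := fun i j => f i * j) hg (const hf.bdd_input 0)
    ((hf.bdd.mul hg.bdd).comp (fun p : {p : ι × ℕ // p.2 < g p.1} => p.1.1) |>.mono
      fun p => Nat.mul_le_mul_left _ p.2.le)
    fun hl _ hv => hv.add (hl hf)

theorem two_pow (hf : SpaceComputable s x f) (hb : PolyBdd s fun i => 2 ^ f i) :
    SpaceComputable s x fun i => 2 ^ f i :=
  rec_of_bdd (v := fun _ j => 2 ^ j) hf (const hf.bdd_input 1)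
    ((hb.comp (fun p : {p : ι × ℕ // p.2 < f p.1} => p.1.1)).mono
      fun p => Nat.pow_le_pow_right (by omega) p.2.le)
    fun hl _ hv => hv.mul (hl (const hf.bdd_input 2))

end SpaceComputable

/-- A family of decidable propositions whose truth values are computable in linear space. -/
def SpaceDecidable {ι : Type} (s x : ι → ℕ) (P : ι → Prop) : Prop :=
  ∃ f : ι → ℕ, SpaceComputable s x f ∧ ∀ i, (P i ∧ f i = 1) ∨ (¬ P i ∧ f i = 0)

namespace SpaceDecidable

open SpaceComputable

variable {ι : Type} {s x f g : ι → ℕ} {P Q : ι → Prop}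

theorem congr (hP : SpaceDecidable s x P) (h : ∀ i, P i ↔ Q i) : SpaceDecidable s x Q := by
  obtain rfl : P = Q := funext fun i => propext (h i)
  exact hP

theorem lt (hf : SpaceComputable s x f) (hg : SpaceComputable s x g) :
    SpaceDecidable s x fun i => f i < g i := by
  have h1 := const hf.bdd_input 1
  exact ⟨_, h1.sub (h1.sub (hg.sub hf)), fun i => by omega⟩

theorem not (hP : SpaceDecidable s x P) : SpaceDecidable s x fun i => ¬ P i := by
  obtain ⟨p, hp, h⟩ := hP
  refine ⟨_, (const hp.bdd_input 1).sub hp, fun i => ?_⟩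
  rcases h i with ⟨h, hi⟩ | ⟨h, hi⟩ <;> simp [h, hi]

theorem and (hP : SpaceDecidable s x P) (hQ : SpaceDecidable s x Q) :
    SpaceDecidable s x fun i => P i ∧ Q i := by
  obtain ⟨p, hp, h⟩ := hP
  obtain ⟨q, hq, h'⟩ := hQ
  refine ⟨_, hp.mul hq, fun i => ?_⟩
  rcases h i with ⟨h, hi⟩ | ⟨h, hi⟩ <;> rcases h' i with ⟨h', hi'⟩ | ⟨h', hi'⟩ <;>
    simp [h, hi, h', hi']

theorem or (hP : SpaceDecidable s x P) (hQ : SpaceDecidable s x Q) :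
    SpaceDecidable s x fun i => P i ∨ Q i :=
  (hP.not.and hQ.not).not.congr fun i => by tauto

theorem le (hf : SpaceComputable s x f) (hg : SpaceComputable s x g) :
    SpaceDecidable s x fun i => f i ≤ g i :=
  (lt hg hf).not.congr fun _ => not_lt

theorem eq (hf : SpaceComputable s x f) (hg : SpaceComputable s x g) :
    SpaceDecidable s x fun i => f i = g i :=
  ((le hf hg).and (le hg hf)).congr fun i => by omega

theorem ite [DecidablePred P] (hP : SpaceDecidable s x P) (hf : SpaceComputable s x f)
    (hg : SpaceComputable s x g) : SpaceComputable s x fun i => if P i then f i else g i := by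
  obtain ⟨p, hp, h⟩ := hP
  refine ((hp.mul hf).add (((const hp.bdd_input 1).sub hp).mul hg)).congr fun i => ?_
  rcases h i with ⟨h, hi⟩ | ⟨h, hi⟩ <;> simp [h, hi]

end SpaceDecidable

/-- The least `q < N` that satisfies `P`, or `N` if there is none; `v ↦ if P v then v else v + 1`
is iterated `N` times. -/
def leastBelow (P : ℕ → Prop) [DecidablePred P] : ℕ → ℕ
  | 0 => 0
  | j + 1 => if P (leastBelow P j) then leastBelow P j else leastBelow P j + 1

theorem leastBelow_le (P : ℕ → Prop) [DecidablePred P] (N : ℕ) : leastBelow P N ≤ N := by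
  induction N with
  | zero => exact le_rfl
  | succ N ih => rw [leastBelow]; split_ifs <;> omega

theorem leastBelow_spec (P : ℕ → Prop) [DecidablePred P] {N : ℕ} (h : ∃ q < N, P q) :
    leastBelow P N < N ∧ P (leastBelow P N) := by
  have key : ∀ N, (∀ q < leastBelow P N, ¬ P q) ∧ (P (leastBelow P N) ∨ leastBelow P N = N) := by
    intro N
    induction N with
    | zero => exact ⟨by simp [leastBelow], .inr rfl⟩
    | succ N ih =>
      rw [leastBelow]
      split_ifs with hP
      · exact ⟨ih.1, .inl hP⟩
      · refine ⟨fun q hq => ?_, .inr ?_⟩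
        · rcases Nat.lt_succ_iff_lt_or_eq.1 hq with h | rfl
          · exact ih.1 q h
          · exact hP
        · rw [ih.2.resolve_left hP]
  obtain ⟨q, hq, hPq⟩ := h
  have h1 := key N
  have h2 : leastBelow P N ≤ q := by
    by_contra hlt
    exact h1.1 q (by omega) hPq
  exact ⟨by omega, h1.2.resolve_right (by omega)⟩

namespace SpaceComputable

variable {ι : Type} {s x f g : ι → ℕ}

open SpaceDecidable

theorem div (hf : SpaceComputable s x f) (hg : SpaceComputable s x g) :
    SpaceComputable s x fun i => f i / g i :=
  rec_of_bdd (v := fun i j => j / g i) hf ((const hf.bdd_input 0).congr fun i => by simp)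
    ((hf.bdd.comp (fun p : {p : ι × ℕ // p.2 < f p.1} => p.1.1)).mono
      fun p => (Nat.div_le_self _ _).trans p.2.le)
    fun hl hj hv => ((SpaceDecidable.eq (hv.succ.mul (hl hg)) hj.succ).ite hv.succ hv).congr
      fun p => by
        rw [Nat.succ_div]
        by_cases hd : g p.1.1 ∣ p.1.2 + 1
        · have h := Nat.div_mul_cancel hd
          rw [Nat.succ_div, if_pos hd] at h
          rw [if_pos h, if_pos hd]
        · rw [if_neg hd, if_neg, add_zero]
          exact fun h => hd ⟨_, by rw [← h, mul_comm]⟩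

theorem mod (hf : SpaceComputable s x f) (hg : SpaceComputable s x g) :
    SpaceComputable s x fun i => f i % g i :=
  (hf.sub (hg.mul (hf.div hg))).congr fun i => by
    have := Nat.mod_add_div (f i) (g i)
    omega

theorem size (hf : SpaceComputable s x f) : SpaceComputable s x fun i => (f i).size := by
  have hpow : ∀ m : ℕ, 2 ^ m.size ≤ 2 * m + 1 := by
    intro m
    rcases Nat.eq_zero_or_pos m with rfl | h
    · simp
    · have h1 : 2 ^ (m.size - 1) ≤ m := Nat.lt_size.1 (by have := Nat.size_pos.2 h; omega)
      have h2 : m.size = m.size - 1 + 1 := by have := Nat.size_pos.2 h; omega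
      rw [h2, pow_succ]
      omega
  have hle : ∀ m : ℕ, m.size ≤ 2 * m + 1 := fun m => Nat.lt_two_pow_self.le.trans (hpow m)
  let φ : {p : ι × ℕ // p.2 < f p.1} → ι := fun p => p.1.1
  have hb : PolyBdd (fun p : {p : ι × ℕ // p.2 < f p.1} => s p.1.1)
      (fun p => 2 * f p.1.1 + 1) :=
    (((PolyBdd.const 2).mul hf.bdd).add (.const 1)).comp φ
  refine rec_of_bdd (v := fun _ j => j.size) hf (const hf.bdd_input 0)
    (hb.mono fun p => (hle _).trans (by have := p.2; omega)) fun hl hj hv => ?_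
  refine ((SpaceDecidable.le (hv.two_pow (hb.mono fun p => (hpow _).trans
    (by have := p.2; omega))) hj.succ).ite hv.succ hv).congr fun p => ?_
  have h1 : p.1.2.size ≤ (p.1.2 + 1).size := Nat.size_le_size (by omega)
  have h2 : (p.1.2 + 1).size ≤ p.1.2.size + 1 := by
    rw [Nat.size_le, pow_succ]
    have := Nat.lt_size_self p.1.2
    omega
  split_ifs with h
  · have := Nat.lt_size.2 h
    omega
  · have := Nat.size_le.2 (not_le.1 h)
    omega

/-- Bounded search. The predicate is to be decided in any context from which the original functions
and a bounded number `q` can be computed. -/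
theorem leastBelow {N : ι → ℕ} {P : ι → ℕ → Prop} [∀ i, DecidablePred (P i)]
    (hN : SpaceComputable s x N)
    (hP : ∀ {κ : Type} {φ : κ → ι} {y q : κ → ℕ},
      (∀ {f : ι → ℕ}, SpaceComputable s x f → SpaceComputable (s ∘ φ) y (f ∘ φ)) →
      SpaceComputable (s ∘ φ) y q → (∀ k, q k ≤ N (φ k)) →
      SpaceDecidable (s ∘ φ) y fun k => P (φ k) (q k)) :
    SpaceComputable s x fun i => WStream.leastBelow (P i) (N i) := by
  have hle : ∀ p : {p : ι × ℕ // p.2 < N p.1}, WStream.leastBelow (P p.1.1) p.1.2 ≤ N p.1.1 :=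
    fun p => (leastBelow_le _ _).trans p.2.le
  refine rec_of_bdd (v := fun i j => WStream.leastBelow (P i) j) hN (const hN.bdd_input 0)
    ((hN.bdd.comp fun p : {p : ι × ℕ // p.2 < N p.1} => p.1.1).mono hle) fun {y} hl hj hv => ?_
  exact (hP (φ := fun p : {p : ι × ℕ // p.2 < N p.1} => p.1.1) hl hv hle).ite hv hv.succ

end SpaceComputable

/-! ### Arrays stored in numbers -/

/-- Entry `i` of the array `A` of numbers below `2 ^ w`, stored as the digits of `A` in base
`2 ^ w`. For `w = 1` these are the bits of `A`. -/
def digit (w A i : ℕ) : ℕ := A / 2 ^ (w * i) % 2 ^ w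

/-- The array `A` with entry `i` replaced by `x` (reduced modulo `2 ^ w`). -/
def setDigit (w A i x : ℕ) : ℕ :=
  A % 2 ^ (w * i) + 2 ^ (w * i) * (x % 2 ^ w + 2 ^ w * (A / 2 ^ (w * (i + 1))))

theorem digit_lt (w A i : ℕ) : digit w A i < 2 ^ w := Nat.mod_lt _ (by positivity)

theorem digit_zero (w i : ℕ) : digit w 0 i = 0 := by simp [digit]

theorem digit_one_ne_zero {A i : ℕ} : digit 1 A i ≠ 0 ↔ digit 1 A i = 1 := by
  have := digit_lt 1 A i
  omega

theorem setDigit_div (w A i x : ℕ) :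
    setDigit w A i x / 2 ^ (w * i) = x % 2 ^ w + 2 ^ w * (A / 2 ^ (w * (i + 1))) := by
  rw [setDigit, Nat.add_mul_div_left _ _ (by positivity),
    Nat.div_eq_of_lt (Nat.mod_lt _ (by positivity)), zero_add]

theorem setDigit_mod (w A i x : ℕ) : setDigit w A i x % 2 ^ (w * i) = A % 2 ^ (w * i) := by
  rw [setDigit, Nat.add_mul_mod_self_left, Nat.mod_mod]

theorem digit_setDigit_self {w x : ℕ} (A i : ℕ) (hx : x < 2 ^ w) :
    digit w (setDigit w A i x) i = x := by
  rw [digit, setDigit_div, Nat.add_mul_mod_self_left, Nat.mod_mod, Nat.mod_eq_of_lt hx]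

theorem digit_mod {w A i j : ℕ} (h : j < i) : digit w (A % 2 ^ (w * i)) j = digit w A j := by
  have h1 : w * i = w * j + (w + w * (i - j - 1)) := by
    obtain ⟨d, rfl⟩ := Nat.exists_eq_add_of_lt h
    rw [show j + d + 1 - j - 1 = d by omega]
    ring
  rw [digit, digit, h1, pow_add, Nat.mod_mul_right_div_self, pow_add, Nat.mod_mul_right_mod]

theorem digit_div {w A i j : ℕ} (h : i < j) :
    digit w A j = A / 2 ^ (w * (i + 1)) / 2 ^ (w * (j - i - 1)) % 2 ^ w := by
  rw [Nat.div_div_eq_div_mul, ← pow_add, ← mul_add, show i + 1 + (j - i - 1) = j by omega, digit]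

theorem digit_setDigit_ne {i j : ℕ} (w A x : ℕ) (h : i ≠ j) :
    digit w (setDigit w A i x) j = digit w A j := by
  rcases h.lt_or_gt with h | h
  · rw [digit_div h, digit_div h, mul_add, mul_one, pow_add, ← Nat.div_div_eq_div_mul,
      setDigit_div, Nat.add_mul_div_left _ _ (by positivity),
      Nat.div_eq_of_lt (Nat.mod_lt _ (by positivity)), zero_add, ← pow_add, mul_add, mul_one]
  · rw [← digit_mod h, setDigit_mod, digit_mod h]

theorem digit_setDigit {w x : ℕ} (A i j : ℕ) (hx : x < 2 ^ w) :
    digit w (setDigit w A i x) j = if i = j then x else digit w A j := by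
  split_ifs with h
  · rw [← h, digit_setDigit_self A i hx]
  · exact digit_setDigit_ne w A x h

theorem setDigit_lt {w A i N : ℕ} (x : ℕ) (hA : A < 2 ^ (w * N)) (hi : i < N) :
    setDigit w A i x < 2 ^ (w * N) := by
  obtain ⟨d, rfl⟩ := Nat.exists_eq_add_of_lt hi
  have h1 : w * (i + d + 1) = w * i + (w + w * d) := by ring
  have h2 : A / 2 ^ (w * (i + 1)) < 2 ^ (w * d) := by
    rw [Nat.div_lt_iff_lt_mul (by positivity), ← pow_add]
    convert hA using 2
    ring
  have h3 : x % 2 ^ w < 2 ^ w := Nat.mod_lt _ (by positivity)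
  have h4 : A % 2 ^ (w * i) < 2 ^ (w * i) := Nat.mod_lt _ (by positivity)
  rw [h1, pow_add _ (w * i), pow_add _ w, setDigit]
  generalize A / 2 ^ (w * (i + 1)) = Y at *
  have h5 : x % 2 ^ w + 2 ^ w * Y + 1 ≤ 2 ^ w * 2 ^ (w * d) := by
    calc _ ≤ 2 ^ w * (Y + 1) := by rw [Nat.mul_succ]; omega
      _ ≤ _ := Nat.mul_le_mul_left _ h2
  generalize x % 2 ^ w + 2 ^ w * Y = Z at *
  calc _ < 2 ^ (w * i) * (Z + 1) := by rw [Nat.mul_succ]; omega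
    _ ≤ _ := Nat.mul_le_mul_left _ h5

/-! ### The algorithm -/

/-- The parameters of the algorithm. A color is a number `b * positions + q`, where `b` is one of
`2 ^ shiftBits` blocks and `q` one of the `positions` in this block. -/
structure Params where
  /-- the number of bits of an entry of the arrays in the memory -/
  cell : ℕ
  /-- the binary logarithm of the number of blocks -/
  shiftBits : ℕ
  /-- the number of colors in a block -/
  positions : ℕ
  /-- the number of edges to later vertices after which a vertex passes on to its next block -/
  period : ℕ
  /-- whether there is only one block, in which every vertex ever visits and all of whose colors
  it remembers; polarities are then ignored -/
  small : Bool

/-- The content of the memory. The arrays are indexed by vertices and stored as in `digit`. -/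
structure Memory where
  /-- the vertex that arrived last -/
  cur : ℕ
  /-- the set of the colors of the edges from `cur` to earlier vertices, as a bitmap -/
  taken : ℕ
  /-- the array of the random bits drawn by the vertices at their arrivals -/
  coin : ℕ
  /-- the array of the numbers of edges to later vertices -/
  count : ℕ
  /-- the array of the sets of the positions in the current block that are out of use -/
  used : ℕ

namespace Params

variable (P : Params)

/-- The block that is visited by a vertex with random bits `ρ` and `c` edges to later vertices. -/
def block (ρ c : ℕ) : ℕ := (ρ + c / P.period) % 2 ^ P.shiftBits

/-- The polarity of the position `q` at a vertex with random bits `ρ`: position `q` is reserved for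
edges to later vertices if it is `0`, and for edges to earlier ones if it is `1`. -/
def polarity (ρ q : ℕ) : ℕ := digit 1 ρ (P.shiftBits + q)

end Params

namespace Memory

/-- The coding of memory contents by numbers. -/
def code (M : Memory) : ℕ :=
  Nat.pair M.cur (Nat.pair M.taken (Nat.pair M.coin (Nat.pair M.count M.used)))

variable (P : Params) (M : Memory)

/-- The block in which an edge from the current vertex to the earlier vertex `u` is colored. -/
def block (u : ℕ) : ℕ := P.block (digit P.cell M.coin u) (digit P.cell M.count u)

/-- The position `q` is available for an edge from the current vertex to the earlier vertex `u`. -/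
def Free (u q : ℕ) : Prop :=
  (P.small = true ∨ (P.polarity (digit P.cell M.coin u) q = 0 ∧
    P.polarity (digit P.cell M.coin M.cur) q = 1)) ∧
  digit 1 (digit P.cell M.used u) q = 0 ∧
  digit 1 M.taken (M.block P u * P.positions + q) = 0

instance (u : ℕ) : DecidablePred (M.Free P u) := fun q => by unfold Free; infer_instance

/-- The position of the color chosen for an edge from the current vertex to `u`. -/
def position (u : ℕ) : ℕ := leastBelow (M.Free P u) P.positions

/-- The color chosen for an edge from the current vertex to `u`. -/
def color (u : ℕ) : ℕ := M.block P u * P.positions + M.position P u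

/-- The memory after the arrival of the vertex `v`, which draws the random bits `ρ`. -/
def arrive (v ρ : ℕ) : Memory :=
  { M with cur := v, taken := 0, coin := setDigit P.cell M.coin v ρ }

/-- The memory after an edge from the current vertex to the vertex `u` has been colored. The position
is also marked as used at the current vertex. This is needed if there is only one block. Otherwise
it has no effect, since the polarity at the current vertex excludes this position anyway from its
edges to later vertices. -/
def addEdge (u : ℕ) : Memory :=
  let c := digit P.cell M.count u + 1
  let A := setDigit P.cell M.used M.cur
    (setDigit 1 (digit P.cell M.used M.cur) (M.position P u) 1)
  { M with
    taken := setDigit 1 M.taken (M.color P u) 1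
    count := setDigit P.cell M.count u c
    used := setDigit P.cell A u
      (if c % P.period = 0 then 0 else setDigit 1 (digit P.cell M.used u) (M.position P u) 1) }

/-- The memory after the token with number `t`, at which the random bits `ρ` are drawn. -/
def step (t ρ : ℕ) : Memory :=
  if t = 0 then M
  else if t % 2 = 1 then M.arrive P (t / 2) ρ
  else if M.position P (t / 2 - 1) < P.positions then M.addEdge P (t / 2 - 1) else M

/-- The number of the record printed at the token with number `t` (see `decodeRecord`). -/
def output (t : ℕ) : ℕ :=
  if t = 0 ∨ t % 2 = 1 then 0
  else Nat.pair (t / 2 - 1) (Nat.pair M.cur (M.color P (t / 2 - 1))) + 1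

/-- The sizes of the parts of the memory when there are `n` vertices. -/
structure Bounded (n : ℕ) : Prop where
  cur : M.cur < n
  taken : M.taken < 2 ^ (1 * (2 ^ P.shiftBits * P.positions))
  coin : M.coin < 2 ^ (P.cell * n)
  count : M.count < 2 ^ (P.cell * n)
  used : M.used < 2 ^ (P.cell * n)

end Memory

theorem Params.block_lt (P : Params) (ρ c : ℕ) : P.block ρ c < 2 ^ P.shiftBits :=
  Nat.mod_lt _ (by positivity)

theorem Params.block_mul_add_le (P : Params) (ρ c : ℕ) {q : ℕ} (hq : q ≤ P.positions) :
    P.block ρ c * P.positions + q ≤ 2 ^ P.shiftBits * P.positions :=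
  calc _ ≤ (P.block ρ c + 1) * P.positions := by rw [add_mul]; omega
    _ ≤ _ := Nat.mul_le_mul_right _ (P.block_lt ρ c)

theorem Memory.color_lt {P : Params} {M : Memory} {u : ℕ} (h : M.position P u < P.positions) :
    M.color P u < 2 ^ P.shiftBits * P.positions :=
  lt_of_lt_of_le (Nat.lt_succ_self _) (P.block_mul_add_le _ _ h)

theorem Memory.Bounded.step {P : Params} {M : Memory} {n t : ℕ} (hM : M.Bounded P n) (ρ : ℕ)
    (ht : t ≤ 2 * n) : (M.step P t ρ).Bounded P n := by
  unfold Memory.step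
  split_ifs with h0 h1 h2
  · exact hM
  · exact { hM with
      cur := by simp only [arrive]; omega
      taken := by simp only [arrive]; positivity
      coin := setDigit_lt _ hM.coin (by omega) }
  · exact { hM with
      taken := setDigit_lt _ hM.taken (Memory.color_lt h2)
      count := setDigit_lt _ hM.count (by omega)
      used := setDigit_lt _ (setDigit_lt _ hM.used hM.cur) (by omega) }
  · exact hM

/-- The threshold for `Δ` from which on the algorithm uses several blocks. Each of at most
`17 * n ^ 2` bad events will have probability at most `2 ^ (-threshold c n)`, and `c + 7` is large
enough for a union bound (see `threshold_spec`). -/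
def threshold (c n : ℕ) : ℕ := (c + 7) * n.size

/-- The parameters for `n` vertices and maximum degree `Δ`. If `Δ` is below the threshold, there is
one block of `2 * Δ + 1` colors, and no period ever ends. Otherwise, the number of blocks is at
least `8 * Δ / threshold c n`, so that on average a vertex has at most `threshold c n / 8` edges to
earlier vertices in a block. -/
def params (c n Δ : ℕ) : Params :=
  if Δ < threshold c n then
    { cell := 2 * Δ + 1 + n.size, shiftBits := 0, positions := 2 * Δ + 1, period := Δ + 1,
      small := true }
  else
    { cell := (Δ / threshold c n).size + 3 + 16 * threshold c n + n.size
      shiftBits := (Δ / threshold c n).size + 3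
      positions := 16 * threshold c n, period := threshold c n, small := false }

/-- The number of random bits drawn at each token. -/
def Params.coins (P : Params) : ℕ := P.shiftBits + P.positions

theorem params_cell (c n Δ : ℕ) :
    (params c n Δ).cell = (params c n Δ).coins + n.size := by
  unfold params Params.coins
  split_ifs <;> simp

theorem threshold_pos {n : ℕ} (c : ℕ) (hn : 1 ≤ n) : 0 < threshold c n :=
  Nat.mul_pos (by omega) (Nat.size_pos.2 hn)

theorem params_coins_le {c n Δ : ℕ} (hn : 1 ≤ n) (hΔ : Δ ≤ n) :
    (params c n Δ).coins ≤ (16 * c + 116) * n.size := by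
  have h0 := Nat.size_pos.2 hn
  have h1 : (16 * c + 116) * n.size = 16 * threshold c n + 4 * n.size := by
    unfold threshold; ring
  have h2 : (Δ / threshold c n).size ≤ n.size :=
    Nat.size_le_size ((Nat.div_le_self _ _).trans hΔ)
  unfold params Params.coins
  split_ifs with h <;> simp only <;> omega

theorem two_pow_size_le {m : ℕ} (h : 0 < m) : 2 ^ m.size ≤ 2 * m := by
  have h0 := Nat.size_pos.2 h
  have h1 : 2 ^ (m.size - 1) ≤ m := Nat.lt_size.1 (by omega)
  have h2 : m.size = m.size - 1 + 1 := by omega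
  rw [h2, pow_succ]
  omega

theorem params_colors_le {c n Δ : ℕ} (hn : 1 ≤ n) (hΔ : 1 ≤ Δ) :
    2 ^ (params c n Δ).shiftBits * (params c n Δ).positions ≤ 256 * Δ := by
  unfold params
  split_ifs with h
  · simp only; omega
  · have hd : 0 < Δ / threshold c n := Nat.div_pos (not_lt.1 h) (threshold_pos c hn)
    have h1 := two_pow_size_le hd
    have h2 := Nat.div_mul_le_self Δ (threshold c n)
    simp only [pow_add]
    calc 2 ^ (Δ / threshold c n).size * 2 ^ 3 * (16 * threshold c n)
        ≤ (2 * (Δ / threshold c n)) * 2 ^ 3 * (16 * threshold c n) := by gcongr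
      _ = 256 * (Δ / threshold c n * threshold c n) := by ring
      _ ≤ _ := by omega

theorem params_colors_le' {c n Δ : ℕ} (hn : 1 ≤ n) (hΔ : Δ ≤ n) :
    2 ^ (params c n Δ).shiftBits * (params c n Δ).positions ≤ 256 * n := by
  rcases Nat.eq_zero_or_pos Δ with rfl | h
  · have := threshold_pos c hn
    rw [params, if_pos this]
    simp only; omega
  · exact (params_colors_le hn h).trans (by omega)

theorem params_period_pos {c n Δ : ℕ} (hn : 1 ≤ n) : 0 < (params c n Δ).period := by
  unfold params
  split_ifs
  · exact Nat.succ_pos Δ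
  · exact threshold_pos c hn

theorem params_div_period_lt (c n Δ : ℕ) :
    Δ / (params c n Δ).period < 2 ^ (params c n Δ).shiftBits := by
  unfold params
  split_ifs
  · simp
  · exact (Nat.lt_size_self _).trans_le (Nat.pow_le_pow_right (by omega) (Nat.le_add_right _ _))

open SpaceComputable

/-! ### The programs of the algorithm -/

theorem PolyBdd.two_pow {ι : Type} {s b f : ι → ℕ} (C : ℕ) (hs : ∀ i, 2 ^ b i ≤ s i)
    (h : ∀ i, f i ≤ C * b i) : PolyBdd s fun i => 2 ^ f i :=
  ⟨C, fun i => calc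
    2 ^ f i ≤ 2 ^ (b i * C) := Nat.pow_le_pow_right (by omega) (by rw [mul_comm]; exact h i)
    _ = (2 ^ b i) ^ C := pow_mul _ _ _
    _ ≤ (s i + 2) ^ C := Nat.pow_le_pow_left ((hs i).trans (by omega)) C⟩

theorem params_small (c n Δ : ℕ) : (params c n Δ).small = true ↔ Δ < threshold c n := by
  unfold params
  split_ifs with h <;> simp [h]

namespace SpaceComputable

variable {ι : Type} {s x w A i y n Δ : ι → ℕ}

theorem digit (hw : SpaceComputable s x w) (hA : SpaceComputable s x A)
    (hi : SpaceComputable s x i) (hb : PolyBdd s fun k => 2 ^ (w k * (i k + 1))) :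
    SpaceComputable s x fun k => digit (w k) (A k) (i k) :=
  (hA.div ((hw.mul hi).two_pow (hb.mono fun k =>
    Nat.pow_le_pow_right (by omega) (Nat.mul_le_mul_left _ (by omega))))).mod
    (hw.two_pow (hb.mono fun k => Nat.pow_le_pow_right (by omega)
      (Nat.le_mul_of_pos_right _ (by omega))))

theorem setDigit (hw : SpaceComputable s x w) (hA : SpaceComputable s x A)
    (hi : SpaceComputable s x i) (hy : SpaceComputable s x y)
    (hb : PolyBdd s fun k => 2 ^ (w k * (i k + 1))) :
    SpaceComputable s x fun k => setDigit (w k) (A k) (i k) (y k) := by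
  have h1 : SpaceComputable s x fun k => 2 ^ (w k * i k) :=
    (hw.mul hi).two_pow (hb.mono fun k =>
      Nat.pow_le_pow_right (by omega) (Nat.mul_le_mul_left _ (by omega)))
  have h2 : SpaceComputable s x fun k => 2 ^ w k :=
    hw.two_pow (hb.mono fun k => Nat.pow_le_pow_right (by omega)
      (Nat.le_mul_of_pos_right _ (by omega)))
  have h3 : SpaceComputable s x fun k => 2 ^ (w k * (i k + 1)) := (hw.mul hi.succ).two_pow hb
  exact (hA.mod h1).add (h1.mul ((hy.mod h2).add (h2.mul (hA.div h3))))

theorem threshold (c : ℕ) (hn : SpaceComputable s x n) :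
    SpaceComputable s x fun k => threshold c (n k) :=
  (const hn.bdd_input (c + 7)).mul hn.size

theorem shiftBits (c : ℕ) (hn : SpaceComputable s x n) (hΔ : SpaceComputable s x Δ) :
    SpaceComputable s x fun k => (params c (n k) (Δ k)).shiftBits := by
  have ht := hn.threshold c
  refine ((SpaceDecidable.lt hΔ ht).ite (const hn.bdd_input 0)
    ((hΔ.div ht).size.add (const hn.bdd_input 3))).congr fun k => ?_
  unfold params
  split_ifs <;> rfl

theorem positions (c : ℕ) (hn : SpaceComputable s x n) (hΔ : SpaceComputable s x Δ) :
    SpaceComputable s x fun k => (params c (n k) (Δ k)).positions := by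
  have ht := hn.threshold c
  refine ((SpaceDecidable.lt hΔ ht).ite ((const hn.bdd_input 2).mul hΔ).succ
    ((const hn.bdd_input 16).mul ht)).congr fun k => ?_
  unfold params
  split_ifs <;> rfl

theorem period (c : ℕ) (hn : SpaceComputable s x n) (hΔ : SpaceComputable s x Δ) :
    SpaceComputable s x fun k => (params c (n k) (Δ k)).period := by
  have ht := hn.threshold c
  refine ((SpaceDecidable.lt hΔ ht).ite hΔ.succ ht).congr fun k => ?_
  unfold params
  split_ifs <;> rfl

theorem coins (c : ℕ) (hn : SpaceComputable s x n) (hΔ : SpaceComputable s x Δ) :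
    SpaceComputable s x fun k => (params c (n k) (Δ k)).coins :=
  (hn.shiftBits c hΔ).add (hn.positions c hΔ)

theorem cell (c : ℕ) (hn : SpaceComputable s x n) (hΔ : SpaceComputable s x Δ) :
    SpaceComputable s x fun k => (params c (n k) (Δ k)).cell :=
  ((hn.coins c hΔ).add hn.size).congr fun k => (params_cell c (n k) (Δ k)).symm

end SpaceComputable

/-- The situation when a token is processed in an admissible run. -/
structure Config (c : ℕ) where
  /-- the number of vertices -/
  n : ℕ
  /-- the maximum degree -/
  Δ : ℕ
  /-- the content of the memory -/
  M : Memory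
  /-- the number of the token -/
  t : ℕ
  /-- the random bits drawn at the token -/
  ρ : ℕ
  one_le : 1 ≤ n
  Δ_le : Δ ≤ n
  bounded : M.Bounded (params c n Δ) n
  t_le : t ≤ 2 * n
  ρ_lt : ρ < 2 ^ (params c n Δ).coins

namespace Config

variable {c : ℕ}

/-- The parameters of the algorithm. -/
abbrev P (i : Config c) : Params := params c i.n i.Δ

/-- What the programs can access. -/
def view (i : Config c) : ℕ := Algorithm.view i.n i.Δ i.M.code i.t i.ρ

/-- The space bound, up to a constant factor. -/
def bits (i : Config c) : ℕ := i.n * i.n.size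

/-- The largest number allowed by the space bound, up to a constant exponent. -/
def scale (i : Config c) : ℕ := 2 ^ i.bits

theorem n_le_bits (i : Config c) : i.n ≤ i.bits :=
  Nat.le_mul_of_pos_right _ (Nat.size_pos.2 i.one_le)

theorem size_le_bits (i : Config c) : i.n.size ≤ i.bits := Nat.le_mul_of_pos_left _ i.one_le

theorem one_le_bits (i : Config c) : 1 ≤ i.bits := i.one_le.trans i.n_le_bits

theorem coins_le (i : Config c) : i.P.coins ≤ (16 * c + 116) * i.bits :=
  (params_coins_le i.one_le i.Δ_le).trans (Nat.mul_le_mul_left _ i.size_le_bits)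

theorem cell_mul_le (i : Config c) {m : ℕ} (hm : m ≤ 2 * i.n) :
    i.P.cell * m ≤ (2 * (16 * c + 117)) * i.bits := by
  have h : i.P.cell ≤ (16 * c + 117) * i.n.size := by
    rw [params_cell]
    have := params_coins_le (c := c) i.one_le i.Δ_le
    rw [show 16 * c + 117 = 16 * c + 116 + 1 by ring, add_mul]
    omega
  calc i.P.cell * m ≤ (16 * c + 117) * i.n.size * (2 * i.n) := Nat.mul_le_mul h hm
    _ = _ := by rw [bits]; ring

theorem colors_le (i : Config c) : 2 ^ i.P.shiftBits * i.P.positions ≤ 256 * i.bits :=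
  (params_colors_le' i.one_le i.Δ_le).trans (Nat.mul_le_mul_left _ i.n_le_bits)

theorem polyBdd_two_pow {f : Config c → ℕ} (C : ℕ) (h : ∀ i, f i ≤ C * i.bits) :
    PolyBdd scale fun i => 2 ^ f i :=
  .two_pow (b := bits) C (fun _ => le_rfl) h

theorem polyBdd_cell_succ {f : Config c → ℕ} (h : ∀ i, f i ≤ i.n) :
    PolyBdd scale fun i => 2 ^ (i.P.cell * (f i + 1)) :=
  polyBdd_two_pow _ fun i => i.cell_mul_le (by have := h i; have := i.one_le; omega)

theorem polyBdd_coins_succ : PolyBdd scale fun i : Config c => 2 ^ (i.P.coins + 1) :=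
  polyBdd_two_pow (16 * c + 117) fun i => by
    have := i.coins_le
    have := i.one_le_bits
    rw [show 16 * c + 117 = 16 * c + 116 + 1 by ring, add_mul]
    omega

theorem polyBdd_of_le_n {f : Config c → ℕ} (C : ℕ) (h : ∀ i, f i ≤ C * i.n) :
    PolyBdd scale f :=
  ((polyBdd_two_pow (f := fun i => i.n.size) 1 fun i => by
    rw [one_mul]; exact i.size_le_bits).mul (.const C)).mono
    fun i => (h i).trans (by
      rw [mul_comm]; exact Nat.mul_le_mul_right _ (Nat.lt_size_self i.n).le)

theorem polyBdd_view : PolyBdd (scale (c := c)) view := by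
  have hA : PolyBdd (scale (c := c)) fun i => 2 ^ (i.P.cell * i.n) :=
    polyBdd_two_pow _ fun i => i.cell_mul_le (by omega)
  refine .pair (polyBdd_of_le_n 1 fun i => by rw [one_mul]) (.pair (polyBdd_of_le_n 1 fun i => by
    have := i.Δ_le; omega) (.pair (.pair ?_ (.pair ?_ (.pair ?_ (.pair ?_ ?_))))
    (.pair (polyBdd_of_le_n 2 fun i => i.t_le) ?_)))
  · exact polyBdd_of_le_n 1 fun i => by have := i.bounded.cur; omega
  · exact (polyBdd_two_pow 256 fun i => by rw [one_mul]; exact i.colors_le).mono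
      fun i => i.bounded.taken.le
  · exact hA.mono fun i => i.bounded.coin.le
  · exact hA.mono fun i => i.bounded.count.le
  · exact hA.mono fun i => i.bounded.used.le
  · exact (polyBdd_two_pow _ fun i => i.coins_le).mono fun i => i.ρ_lt.le

/-- The functions of the configuration that the algorithm can compute. -/
abbrev Computable (f : Config c → ℕ) : Prop := SpaceComputable scale view f

theorem computable_view : Computable (view (c := c)) := input polyBdd_view

theorem computable_n : Computable (c := c) n :=
  computable_view.fst.congr fun i => by simp [view, Algorithm.view]

theorem computable_Δ : Computable (c := c) Δ :=
  computable_view.snd.fst.congr fun i => by simp [view, Algorithm.view]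

theorem computable_code : Computable (c := c) fun i => i.M.code :=
  computable_view.snd.snd.fst.congr fun i => by simp [view, Algorithm.view]

theorem computable_t : Computable (c := c) t :=
  computable_view.snd.snd.snd.fst.congr fun i => by simp [view, Algorithm.view]

theorem computable_ρ : Computable (c := c) ρ :=
  computable_view.snd.snd.snd.snd.congr fun i => by simp [view, Algorithm.view]

theorem computable_cur : Computable (c := c) fun i => i.M.cur :=
  computable_code.fst.congr fun i => by simp [Memory.code]

theorem computable_taken : Computable (c := c) fun i => i.M.taken :=
  computable_code.snd.fst.congr fun i => by simp [Memory.code]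

theorem computable_coin : Computable (c := c) fun i => i.M.coin :=
  computable_code.snd.snd.fst.congr fun i => by simp [Memory.code]

theorem computable_count : Computable (c := c) fun i => i.M.count :=
  computable_code.snd.snd.snd.fst.congr fun i => by simp [Memory.code]

theorem computable_used : Computable (c := c) fun i => i.M.used :=
  computable_code.snd.snd.snd.snd.congr fun i => by simp [Memory.code]

theorem computable_const (a : ℕ) : Computable (c := c) fun _ => a := const polyBdd_view a

/-- The vertex `u` if the token is an edge from the current vertex to `u`. -/
def other (i : Config c) : ℕ := i.t / 2 - 1

theorem other_lt (i : Config c) : i.other < i.n := by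
  have := i.t_le
  have := i.one_le
  unfold other
  omega

theorem computable_other : Computable (c := c) other :=
  (computable_t.div (computable_const 2)).pred

theorem computable_cell : Computable (c := c) fun i => i.P.cell := computable_n.cell c computable_Δ

theorem computable_shiftBits : Computable (c := c) fun i => i.P.shiftBits :=
  computable_n.shiftBits c computable_Δ

theorem computable_positions : Computable (c := c) fun i => i.P.positions :=
  computable_n.positions c computable_Δ

theorem computable_period : Computable (c := c) fun i => i.P.period :=
  computable_n.period c computable_Δ

theorem computable_digit {A u : Config c → ℕ} (hA : Computable A) (hu : Computable u)
    (h : ∀ i, u i < i.n) : Computable fun i => digit i.P.cell (A i) (u i) :=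
  computable_cell.digit hA hu (polyBdd_cell_succ fun i => (h i).le)

theorem computable_block : Computable (c := c) fun i => i.M.block i.P i.other :=
  ((computable_digit computable_coin computable_other other_lt).add
    ((computable_digit computable_count computable_other other_lt).div computable_period)).mod
    (computable_shiftBits.two_pow (polyBdd_two_pow _ fun i =>
      (Nat.le_add_right _ _).trans i.coins_le))

theorem computable_position : Computable (c := c) fun i => i.M.position i.P i.other := by
  refine computable_positions.leastBelow fun {κ φ y q} hl hq hle => ?_
  have hy := hq.bdd_input
  have hone : SpaceComputable (scale ∘ φ) y fun _ => 1 := const hy 1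
  have hpol : ∀ {A : Config c → ℕ}, Computable A →
      SpaceComputable (scale ∘ φ) y fun k => (φ k).P.polarity (A (φ k)) (q k) := fun hA =>
    hone.digit (hl hA) ((hl computable_shiftBits).add hq)
      ((polyBdd_coins_succ.comp φ).mono fun k => Nat.pow_le_pow_right (by omega) (by
          have := hle k
          unfold Params.coins
          omega))
  have hsmall : SpaceDecidable (scale ∘ φ) y fun k => (φ k).P.small = true :=
    (SpaceDecidable.lt (hl computable_Δ) (hl (computable_n.threshold c))).congr
      fun k => (params_small c (φ k).n (φ k).Δ).symm
  refine ((hsmall.or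
    ((SpaceDecidable.eq (hpol (computable_digit computable_coin computable_other other_lt))
      (const hy 0)).and
    (SpaceDecidable.eq (hpol (computable_digit computable_coin computable_cur
      fun i => i.bounded.cur)) hone))).and ((SpaceDecidable.eq (hone.digit
        (hl (computable_digit computable_used computable_other other_lt)) hq ?_)
      (const hy 0)).and (SpaceDecidable.eq (hone.digit (hl computable_taken)
        ((hl (computable_block.mul computable_positions)).add hq) ?_) (const hy 0))))
  · refine (polyBdd_coins_succ.comp φ).mono fun k => Nat.pow_le_pow_right (by omega) (by
          have := hle k
          unfold Params.coins
          omega)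
  · refine ((polyBdd_two_pow (f := fun i : Config c => 2 ^ i.P.shiftBits * i.P.positions + 1) 257
      fun i => by
        have := i.colors_le
        have := i.one_le_bits
        omega).comp φ).mono fun k => Nat.pow_le_pow_right (by omega) ?_
    rw [one_mul]
    exact Nat.succ_le_succ (Params.block_mul_add_le _ _ _ (hle k))

theorem computable_color : Computable (c := c) fun i => i.M.color i.P i.other :=
  (computable_block.mul computable_positions).add computable_position

theorem position_le (i : Config c) : i.M.position i.P i.other ≤ i.P.positions := leastBelow_le _ _

theorem computable_arrive : Computable (c := c) fun i => (i.M.arrive i.P (i.t / 2) i.ρ).code :=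
  (computable_t.div (computable_const 2)).pair ((computable_const 0).pair
    ((computable_cell.setDigit computable_coin (computable_t.div (computable_const 2)) computable_ρ
      (polyBdd_cell_succ fun i => by have := i.t_le; omega)).pair
    (computable_count.pair computable_used)))

theorem computable_addEdge : Computable (c := c) fun i => (i.M.addEdge i.P i.other).code := by
  have hone := computable_const (c := c) 1
  have hp : PolyBdd scale fun i : Config c => 2 ^ (1 * (i.M.position i.P i.other + 1)) :=
    polyBdd_coins_succ.mono fun i => Nat.pow_le_pow_right (by omega) (by
      have := i.position_le
      unfold Params.coins
      omega)
  have hu := polyBdd_cell_succ (c := c) fun i => i.other_lt.le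
  have hcur := polyBdd_cell_succ (c := c) fun i => i.bounded.cur.le
  have hused : ∀ {u : Config c → ℕ}, Computable u → (∀ i, u i < i.n) →
      Computable fun i => setDigit 1 (digit i.P.cell i.M.used (u i)) (i.M.position i.P i.other) 1 :=
    fun h h' => hone.setDigit (computable_digit computable_used h h') computable_position hone hp
  have hc := (computable_digit computable_count computable_other (c := c) other_lt).succ
  refine computable_cur.pair (.pair ?_ (computable_coin.pair (.pair ?_ ?_)))
  · refine hone.setDigit computable_taken computable_color hone (polyBdd_two_pow 257 fun i => ?_)
    have h1 := i.colors_le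
    have h2 := i.one_le_bits
    have h3 := Params.block_mul_add_le i.P (digit i.P.cell i.M.coin i.other)
      (digit i.P.cell i.M.count i.other) i.position_le
    unfold Memory.color Memory.block
    omega
  · exact computable_cell.setDigit computable_count computable_other hc hu
  · exact computable_cell.setDigit (computable_cell.setDigit computable_used computable_cur
      (hused computable_cur fun i => i.bounded.cur) hcur) computable_other
      ((SpaceDecidable.eq (hc.mod computable_period) (computable_const 0)).ite
        (computable_const 0) (hused computable_other other_lt)) hu

theorem computable_step : Computable (c := c) fun i => (i.M.step i.P i.t i.ρ).code := by
  refine ((SpaceDecidable.eq computable_t (computable_const 0)).ite computable_code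
    ((SpaceDecidable.eq (computable_t.mod (computable_const 2)) (computable_const 1)).ite
      computable_arrive ((SpaceDecidable.lt computable_position computable_positions).ite
        computable_addEdge computable_code))).congr fun i => ?_
  unfold Memory.step other
  split_ifs <;> rfl

theorem computable_output : Computable (c := c) fun i => i.M.output i.P i.t :=
  ((SpaceDecidable.eq computable_t (computable_const 0)).or (SpaceDecidable.eq
    (computable_t.mod (computable_const 2)) (computable_const 1))).ite (computable_const 0)
    (computable_other.pair (computable_cur.pair computable_color)).succ

end Config

theorem SpaceComputable.exists_program {ι : Type} {b x f : ι → ℕ} (hb : ∀ i, 1 ≤ b i)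
    (h : SpaceComputable (fun i => 2 ^ b i) x f) :
    ∃ (p : Nat.Partrec.Code) (C : ℕ), ∀ C', C ≤ C' → ∀ i, evalSpace (C' * b i) p (x i) =
      some (f i) := by
  obtain ⟨p, e, hp⟩ := h.exists_code
  refine ⟨p, 2 * e, fun C' hC i => hp i _ ?_⟩
  have h1 : 2 ^ b i + 2 ≤ 2 ^ (2 * b i) := by
    have h2 : 2 ^ 1 ≤ 2 ^ b i := Nat.pow_le_pow_right (by omega) (hb i)
    rw [two_mul, pow_add]
    nlinarith
  calc (2 ^ b i + 2) ^ e ≤ (2 ^ (2 * b i)) ^ e := Nat.pow_le_pow_left h1 e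
    _ = 2 ^ (2 * e * b i) := by rw [← pow_mul]; ring_nf
    _ ≤ _ := Nat.pow_le_pow_right (by omega) (Nat.mul_le_mul_right _ hC)

theorem exists_coins_program (c : ℕ) :
    ∃ (p : Nat.Partrec.Code) (C : ℕ), ∀ C', C ≤ C' → ∀ n Δ, 1 ≤ n → Δ ≤ n →
      evalSpace (C' * (n * n.size)) p (Nat.pair n Δ) = some (params c n Δ).coins := by
  let b : {q : ℕ × ℕ // 1 ≤ q.1 ∧ q.2 ≤ q.1} → ℕ := fun q => q.1.1 * q.1.1.size
  have hn : PolyBdd (fun q => 2 ^ b q) fun q => q.1.1 :=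
    (PolyBdd.two_pow (b := b) 1 (fun _ => le_rfl) (fun q => by
      rw [one_mul]; exact Nat.le_mul_of_pos_left _ q.2.1)).mono
      fun q => (Nat.lt_size_self q.1.1).le
  have hx : PolyBdd (fun q => 2 ^ b q) fun q => Nat.pair q.1.1 q.1.2 :=
    hn.pair (hn.mono fun q => q.2.2)
  have hin := input hx
  obtain ⟨p, C, hp⟩ := ((hin.fst.congr (g := fun q => q.1.1) fun q => by simp).coins c
    (hin.snd.congr (g := fun q => q.1.2) fun q => by simp)).exists_program
    fun q => Nat.mul_pos q.2.1 (Nat.size_pos.2 q.2.1)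
  exact ⟨p, C, fun C' hC n Δ hn hΔ => hp C' hC ⟨(n, Δ), hn, hΔ⟩⟩

/-- The abstract algorithm is carried out by programs in the required space. -/
theorem exists_algorithm (c : ℕ) :
    ∃ (A : Algorithm) (C : ℕ), ∀ C', C ≤ C' →
      (∀ n Δ, 1 ≤ n → Δ ≤ n →
        evalSpace (C' * (n * n.size)) A.coins (Nat.pair n Δ) = some (params c n Δ).coins) ∧
      ∀ i : Config c, A.process (C' * (i.n * i.n.size)) i.n i.Δ i.M.code i.t i.ρ =
        some ((i.M.step i.P i.t i.ρ).code, (decodeRecord (i.M.output i.P i.t)).toList) := by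
  obtain ⟨p0, C0, h0⟩ := exists_coins_program c
  obtain ⟨p1, C1, h1⟩ := (Config.computable_step (c := c)).exists_program Config.one_le_bits
  obtain ⟨p2, C2, h2⟩ := (Config.computable_const (c := c) 1).exists_program Config.one_le_bits
  have hx : PolyBdd Config.scale fun i : Config c => Nat.pair i.view 0 :=
    Config.polyBdd_view.pair (.const 0)
  obtain ⟨p3, C3, h3⟩ := (Config.computable_output.comp ((fst_input hx).congr
    (g := Config.view (c := c)) fun i => by simp)).exists_program Config.one_le_bits
  refine ⟨⟨p0, p1, p2, p3⟩, C0 + C1 + C2 + C3, fun C' hC => ⟨h0 C' (by omega), fun i => ?_⟩⟩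
  have e1 := h1 C' (by omega) i
  have e2 := h2 C' (by omega) i
  have e3 := h3 C' (by omega) i
  simp only [Config.bits, Config.view] at e1 e2 e3
  simp only [Algorithm.process, e1, e2]
  cases ho : decodeRecord (i.M.output i.P i.t) <;>
    simp [List.range_succ, e3, ho]

/-! ### Runs -/

/-- The list of the records printed on a list of tokens, each with its random bits. -/
def records (P : Params) {n : ℕ} : Memory → List (Token n × ℕ) → List Record
  | _, [] => []
  | M, (t, ρ) :: Z =>
    (decodeRecord (M.output P t.toNat)).toList ++ records P (M.step P t.toNat ρ) Z

/-- The memory after a list of tokens, each with its random bits. -/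
def memoryAfter (P : Params) {n : ℕ} : Memory → List (Token n × ℕ) → Memory
  | M, [] => M
  | M, (t, ρ) :: Z => memoryAfter P (M.step P t.toNat ρ) Z

theorem records_append (P : Params) {n : ℕ} (M : Memory) (Z Z' : List (Token n × ℕ)) :
    records P M (Z ++ Z') = records P M Z ++ records P (memoryAfter P M Z) Z' := by
  induction Z generalizing M with
  | nil => rfl
  | cons z Z ih => simp [records, memoryAfter, ih]

theorem Token.toNat_le {n : ℕ} (t : Token n) : t.toNat ≤ 2 * n := by
  cases t <;> simp only [Token.toNat] <;> omega

theorem exec_eq {c S n Δ : ℕ} {A : Algorithm} (hn : 1 ≤ n) (hΔ : Δ ≤ n)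
    (hA : ∀ i : Config c, i.n = n → A.process S i.n i.Δ i.M.code i.t i.ρ =
      some ((i.M.step i.P i.t i.ρ).code, (decodeRecord (i.M.output i.P i.t)).toList))
    (Z : List (Token n × ℕ)) (hZ : ∀ z ∈ Z, z.2 < 2 ^ (params c n Δ).coins) (M : Memory)
    (hM : M.Bounded (params c n Δ) n) :
    A.exec S n Δ M.code (Z.map fun z => (z.1.toNat, z.2)) =
      some (records (params c n Δ) M Z) := by
  induction Z generalizing M with
  | nil => rfl
  | cons z Z ih =>
    have hp := hA ⟨n, Δ, M, z.1.toNat, z.2, hn, hΔ, hM, z.1.toNat_le, hZ z (by simp)⟩ rfl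
    have := ih (fun z hz => hZ z (by simp [hz])) _ (hM.step z.2 z.1.toNat_le)
    simp only [Config.P] at hp
    simp [Algorithm.exec, hp, this, records]

/-! ### Correctness of the coloring -/

section Correctness

variable {n : ℕ} (G : SimpleGraph (Fin n)) [DecidableRel G.Adj] (τ : Fin n → ℕ)

/-- The number of neighbours of `u` that arrive later than `u`, but before time `i`, where `τ` gives
the arrival times. -/
def laterCount (u : Fin n) (i : ℕ) : ℕ :=
  (Finset.univ.filter fun w => G.Adj u w ∧ τ u < τ w ∧ τ w < i).card

theorem laterCount_mono (u : Fin n) {i j : ℕ} (h : i ≤ j) :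
    laterCount G τ u i ≤ laterCount G τ u j :=
  Finset.card_le_card fun w => by
    simp only [Finset.mem_filter, Finset.mem_univ, true_and]
    exact fun hw => ⟨hw.1, hw.2.1, hw.2.2.trans_le h⟩

theorem laterCount_le (u : Fin n) (i : ℕ) : laterCount G τ u i ≤ G.maxDegree := by
  refine le_trans (Finset.card_le_card fun w => ?_) (G.degree_le_maxDegree u)
  simp only [Finset.mem_filter, Finset.mem_univ, true_and, SimpleGraph.mem_neighborFinset]
  exact fun hw => hw.1

theorem laterCount_lt {u w : Fin n} {i : ℕ} (hw : G.Adj u w) (h : τ u < τ w) (hi : τ w < i) :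
    laterCount G τ u (τ w) < laterCount G τ u i := by
  refine Finset.card_lt_card ⟨fun x => ?_, fun hs => ?_⟩
  · simp only [Finset.mem_filter, Finset.mem_univ, true_and]
    exact fun hw => ⟨hw.1, hw.2.1, hw.2.2.trans hi⟩
  · have := hs (x := w) (by simp [hw, h, hi])
    simp at this

theorem laterCount_succ (hτ : Function.Injective τ) (u v : Fin n) :
    laterCount G τ u (τ v + 1) =
      laterCount G τ u (τ v) + if G.Adj u v ∧ τ u < τ v then 1 else 0 := by
  have h : (Finset.univ.filter fun w => G.Adj u w ∧ τ u < τ w ∧ τ w < τ v + 1) =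
      (Finset.univ.filter fun w => G.Adj u w ∧ τ u < τ w ∧ τ w < τ v) ∪
        if G.Adj u v ∧ τ u < τ v then {v} else ∅ := by
    ext w
    have h1 : τ w < τ v + 1 ↔ τ w < τ v ∨ w = v := by
      rw [Nat.lt_succ_iff_lt_or_eq, hτ.eq_iff]
    split_ifs with h2
    · simp only [Finset.mem_filter, Finset.mem_univ, true_and, h1, Finset.mem_union,
        Finset.mem_singleton]
      constructor
      · tauto
      · rintro (h | rfl) <;> tauto
    · simp only [Finset.mem_filter, Finset.mem_univ, true_and, h1, Finset.union_empty]
      constructor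
      · rintro ⟨h3, h4, h5 | rfl⟩ <;> tauto
      · tauto
  rw [laterCount, h, Finset.card_union_of_disjoint]
  · split_ifs <;> simp [laterCount]
  · rw [Finset.disjoint_left]
    intro w hw
    split_ifs
    · simp only [Finset.mem_singleton]
      rintro rfl
      simp at hw
    · simp

variable (P : Params) (ρ : Fin n → ℕ)

/-- The block in which the edge from `v` to the earlier vertex `u` is colored, when the vertices
draw the random bits `ρ`. -/
def edgeBlock (u v : Fin n) : ℕ := P.block (ρ u) (laterCount G τ u (τ v))

/-- A condition on the random bits `ρ` under which the algorithm succeeds. With one block, there are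
enough positions, and no period ends, whatever the random bits are. With several blocks,
every edge has more than twice as many positions of the right polarities as there are edges from a
vertex within a period, and no vertex has more edges to earlier vertices in a block than this. -/
def Lucky : Prop :=
  (P.small = true ∧ 2 * G.maxDegree < P.positions ∧ G.maxDegree < P.period) ∨
  (P.small = false ∧ (∀ u v, u ≠ v → 2 * P.period < ((Finset.range P.positions).filter fun q =>
      P.polarity (ρ u) q = 0 ∧ P.polarity (ρ v) q = 1).card) ∧
    ∀ v b, (Finset.univ.filter fun u => G.Adj u v ∧ τ u < τ v ∧
      edgeBlock G τ P ρ u v = b).card ≤ P.period)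

/-- The parameters and the random bits fit together and into the arrays. -/
structure Fits : Prop where
  coin_lt : ∀ u, ρ u < 2 ^ P.cell
  degree_lt : G.maxDegree < 2 ^ P.cell
  positions_le : P.positions ≤ P.cell
  period_pos : 0 < P.period
  blocks : G.maxDegree / P.period < 2 ^ P.shiftBits

/-- The color of the edge from `v` to the earlier vertex `u` that is given position `q`. -/
def edgeColor (e : Fin n × Fin n × ℕ) : ℕ :=
  edgeBlock G τ P ρ e.1 e.2.1 * P.positions + e.2.2

/-- The state after the arrival of all vertices before time `i` together with their edges to
earlier vertices, and of the edges of the vertex arriving at time `i` to the vertices in `l`. An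
entry `(u, v, q)` of `H` says that the edge from `v` to the earlier vertex `u` has been given
position `q`. -/
structure Invariant (i : ℕ) (l : List (Fin n)) (M : Memory) (H : List (Fin n × Fin n × ℕ)) :
    Prop where
  coin : ∀ u, τ u < i → digit P.cell M.coin u = ρ u
  count : ∀ u : Fin n, digit P.cell M.count u = laterCount G τ u i + if u ∈ l then 1 else 0
  used_lt : ∀ u : Fin n, digit P.cell M.used u < 2 ^ (1 * P.positions)
  nodup : (H.map fun e => (e.1, e.2.1)).Nodup
  edge : ∀ u v, (∃ q, (u, v, q) ∈ H) ↔
    G.Adj u v ∧ τ u < τ v ∧ (τ v < i ∨ τ v = i ∧ u ∈ l)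
  position_lt : ∀ u v q, (u, v, q) ∈ H → q < P.positions
  polarity : ∀ u v q, (u, v, q) ∈ H →
    P.small = true ∨ P.polarity (ρ u) q = 0 ∧ P.polarity (ρ v) q = 1
  used_of_period : ∀ u v q, (u, v, q) ∈ H →
    laterCount G τ u (τ v) / P.period = digit P.cell M.count u / P.period →
    digit 1 (digit P.cell M.used u) q = 1
  used_of_small : P.small = true → ∀ u v q, (u, v, q) ∈ H →
    digit 1 (digit P.cell M.used v) q = 1
  of_used : ∀ (u : Fin n) q, digit 1 (digit P.cell M.used u) q = 1 →
    (∃ v, (u, v, q) ∈ H ∧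
      laterCount G τ u (τ v) / P.period = digit P.cell M.count u / P.period) ∨
    ∃ w, (w, u, q) ∈ H
  proper : ∀ e ∈ H, ∀ e' ∈ H, e ≠ e' → edgeColor G τ P ρ e = edgeColor G τ P ρ e' →
    e.1 ≠ e'.1 ∧ e.1 ≠ e'.2.1 ∧ e.2.1 ≠ e'.1 ∧ e.2.1 ≠ e'.2.1

/-- What the memory knows about the current vertex `v`. -/
structure CurrentInvariant (v : Fin n) (M : Memory) (H : List (Fin n × Fin n × ℕ)) : Prop where
  cur : M.cur = v
  coin : digit P.cell M.coin v = ρ v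
  taken : ∀ u q, (u, v, q) ∈ H → digit 1 M.taken (edgeColor G τ P ρ (u, v, q)) = 1
  of_taken : ∀ x, digit 1 M.taken x = 1 →
    ∃ u q, (u, v, q) ∈ H ∧ x = edgeColor G τ P ρ (u, v, q)

variable {G τ P ρ} {i : ℕ} {l : List (Fin n)} {M : Memory} {H : List (Fin n × Fin n × ℕ)}

theorem Invariant.zero : Invariant G τ P ρ 0 [] ⟨0, 0, 0, 0, 0⟩ [] where
  coin u hu := absurd hu (Nat.not_lt_zero _)
  count u := by simp [digit_zero, laterCount]
  used_lt u := by simp [digit_zero]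
  nodup := List.nodup_nil
  edge u v := by simp
  position_lt := by simp
  polarity := by simp
  used_of_period := by simp
  used_of_small := by simp
  of_used := by simp [digit_zero]
  proper := by simp

theorem Invariant.eq_of_mem (h : Invariant G τ P ρ i l M H) {u v : Fin n} {q q' : ℕ}
    (h1 : (u, v, q) ∈ H) (h2 : (u, v, q') ∈ H) : q = q' := by
  have := List.inj_on_of_nodup_map h.nodup h1 h2 rfl
  simpa using this

/-- The arrival of the next vertex. -/
theorem Invariant.arrive (h : Invariant G τ P ρ i [] M H) {v : Fin n} (hv : τ v = i)
    (hρ : ρ v < 2 ^ P.cell) :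
    Invariant G τ P ρ i [] (M.arrive P v (ρ v)) H ∧
      CurrentInvariant G τ P ρ v (M.arrive P v (ρ v)) H := by
  refine ⟨{ h with coin := fun u hu => ?_ }, rfl, ?_, fun u q hu => ?_, fun x hx => ?_⟩
  · have hne : (v : ℕ) ≠ u := by
      intro h
      rw [Fin.ext h] at hv
      omega
    rw [← h.coin u hu]
    exact digit_setDigit_ne _ _ _ hne
  · exact digit_setDigit_self _ _ hρ
  · have := ((h.edge u v).1 ⟨q, hu⟩).2.2
    simp [hv] at this
  · simp [Memory.arrive, digit_zero] at hx

/-- All edges from `v` to earlier vertices have been processed. -/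
theorem Invariant.next (hτ : Function.Injective τ) {v : Fin n}
    (h : Invariant G τ P ρ (τ v) l M H) (hc : CurrentInvariant G τ P ρ v M H)
    (hl : ∀ u, u ∈ l ↔ G.Adj v u ∧ τ u < τ v) : Invariant G τ P ρ (τ v + 1) [] M H :=
  { h with
    coin := fun u hu => by
      rcases Nat.lt_succ_iff_lt_or_eq.1 hu with h1 | h1
      · exact h.coin u h1
      · rw [hτ h1, hc.coin]
    count := fun u => by
      rw [h.count, laterCount_succ G τ hτ]
      simp [hl, G.adj_comm v u]
    edge := fun u w => by
      rw [h.edge, Nat.lt_succ_iff_lt_or_eq, hτ.eq_iff]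
      constructor
      · rintro ⟨h1, h2, h3⟩
        exact ⟨h1, h2, .inl (h3.imp_right And.left)⟩
      · rintro ⟨h1, h2, h3 | h3⟩
        · exact ⟨h1, h2, h3.imp_right fun h => ⟨h, by subst h; exact (hl u).2 ⟨h1.symm, h2⟩⟩⟩
        · simp at h3 }

theorem Invariant.block_eq {v u : Fin n} (h : Invariant G τ P ρ (τ v) l M H)
    (hu : τ u < τ v) (hl : u ∉ l) : M.block P u = edgeBlock G τ P ρ u v := by
  rw [Memory.block, edgeBlock, h.coin u hu, h.count u, if_neg hl, add_zero]

theorem Invariant.color_eq {v u : Fin n} (h : Invariant G τ P ρ (τ v) l M H)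
    (hu : τ u < τ v) (hl : u ∉ l) :
    M.color P u = edgeColor G τ P ρ (u, v, M.position P u) := by
  rw [Memory.color, edgeColor, h.block_eq hu hl]

/-- During a period, a vertex gets at most `period` edges to later vertices. -/
theorem card_div_eq_le (hτ : Function.Injective τ) (hP : 0 < P.period) (u : Fin n) (t : ℕ) :
    (Finset.univ.filter fun w => G.Adj u w ∧ τ u < τ w ∧
      laterCount G τ u (τ w) / P.period = t).card ≤ P.period := by
  have h : (Finset.Ico (P.period * t) (P.period * t + P.period)).card = P.period := by simp
  refine le_of_le_of_eq (Finset.card_le_card_of_injOn (fun w => laterCount G τ u (τ w)) ?_ ?_) h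
  · intro w hw
    simp only [Finset.coe_filter, Finset.mem_univ, true_and, Set.mem_ofPred_eq] at hw
    simp only [Finset.coe_Ico, Set.mem_Ico]
    have h1 := Nat.div_add_mod (laterCount G τ u (τ w)) P.period
    have h2 := Nat.mod_lt (laterCount G τ u (τ w)) hP
    rw [hw.2.2] at h1
    omega
  · intro w hw w' hw' heq
    simp only [Finset.coe_filter, Finset.mem_univ, true_and, Set.mem_ofPred_eq] at hw hw'
    simp only at heq
    rcases lt_trichotomy (τ w) (τ w') with h | h | h
    · exact absurd heq (laterCount_lt G τ hw.1 hw.2.1 h).ne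
    · exact hτ h
    · exact absurd heq (laterCount_lt G τ hw'.1 hw'.2.1 h).ne'

/-- If the random bits are lucky, there is an available position. -/
theorem Invariant.exists_free (hτ : Function.Injective τ) {u v : Fin n}
    (h : Invariant G τ P ρ (τ v) l M H) (hc : CurrentInvariant G τ P ρ v M H)
    (hF : Fits G P ρ) (hL : Lucky G τ P ρ) (huv : τ u < τ v) (hl : u ∉ l) :
    ∃ q < P.positions, M.Free P u q := by
  classical
  by_contra hno
  push Not at hno
  have hb := h.block_eq huv hl
  -- `U` and `T` are the positions that are blocked at `u` and at `v`.
  let U := (Finset.range P.positions).filter fun q => digit 1 (digit P.cell M.used u) q = 1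
  let T := (Finset.range P.positions).filter fun q =>
    digit 1 M.taken (M.block P u * P.positions + q) = 1
  have hT : ∀ q ∈ T, ∃ w, (w, v, q) ∈ H ∧ edgeBlock G τ P ρ w v = edgeBlock G τ P ρ u v := by
    intro q hq
    simp only [T, Finset.mem_filter, Finset.mem_range] at hq
    obtain ⟨w, q', hw, heq⟩ := hc.of_taken _ hq.2
    have hq' := h.position_lt _ _ _ hw
    have hpos : 0 < P.positions := by omega
    simp only [edgeColor] at heq
    have h1 := congrArg (· / P.positions) heq
    have h2 := congrArg (· % P.positions) heq
    simp only [Nat.mul_add_mod_self_right, Nat.mod_eq_of_lt hq.1, Nat.mod_eq_of_lt hq'] at h2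
    rw [← h2] at hw heq
    refine ⟨w, hw, ?_⟩
    rw [← hb]
    exact (Nat.eq_of_mul_eq_mul_right hpos (Nat.add_right_cancel heq)).symm
  rcases hL with ⟨hs, hpos, hper⟩ | ⟨hs, hpol, hload⟩
  · -- All positions are blocked, but each neighbour of `u` or `v` blocks at most one.
    have h1 : U.card ≤ G.maxDegree := by
      refine le_trans (Finset.card_le_card_of_forall_subsingleton
        (fun q w => (u, w, q) ∈ H ∨ (w, u, q) ∈ H) (t := G.neighborFinset u) ?_ ?_)
        (G.degree_le_maxDegree u)
      · intro q hq
        simp only [U, Finset.mem_filter, Finset.mem_range] at hq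
        rcases h.of_used u q hq.2 with ⟨w, hw, -⟩ | ⟨w, hw⟩
        · exact ⟨w, by simpa using ((h.edge u w).1 ⟨q, hw⟩).1, .inl hw⟩
        · exact ⟨w, by simpa using ((h.edge w u).1 ⟨q, hw⟩).1.symm, .inr hw⟩
      · rintro w - q ⟨-, hq⟩ q' ⟨-, hq'⟩
        rcases hq with hq | hq <;> rcases hq' with hq' | hq'
        · exact h.eq_of_mem hq hq'
        · have h1 := ((h.edge _ _).1 ⟨_, hq⟩).2.1
          have h2 := ((h.edge _ _).1 ⟨_, hq'⟩).2.1
          omega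
        · have h1 := ((h.edge _ _).1 ⟨_, hq⟩).2.1
          have h2 := ((h.edge _ _).1 ⟨_, hq'⟩).2.1
          omega
        · exact h.eq_of_mem hq hq'
    have h2 : T.card ≤ G.maxDegree := by
      refine le_trans (Finset.card_le_card_of_forall_subsingleton
        (fun q w => (w, v, q) ∈ H) (t := G.neighborFinset v) ?_ ?_)
        (G.degree_le_maxDegree v)
      · intro q hq
        obtain ⟨w, hw, -⟩ := hT q hq
        exact ⟨w, by simpa using ((h.edge w v).1 ⟨q, hw⟩).1.symm, hw⟩
      · rintro w - q ⟨-, hq⟩ q' ⟨-, hq'⟩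
        exact h.eq_of_mem hq hq'
    have h3 : Finset.range P.positions ⊆ U ∪ T := by
      intro q hq
      have hn := hno q (Finset.mem_range.1 hq)
      simp only [Memory.Free, hs, true_or, true_and, not_and_or] at hn
      simp only [U, T, Finset.mem_union, Finset.mem_filter, hq, true_and]
      exact hn.imp digit_one_ne_zero.1 digit_one_ne_zero.1
    have h4 := (Finset.card_le_card h3).trans (Finset.card_union_le _ _)
    rw [Finset.card_range] at h4
    omega
  · -- Among the positions of the right polarities, at most `period` are blocked at each end.
    let R := (Finset.range P.positions).filter fun q =>
      P.polarity (ρ u) q = 0 ∧ P.polarity (ρ v) q = 1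
    have hR : 2 * P.period < R.card := hpol u v (by rintro rfl; omega)
    have h1 : (R ∩ U).card ≤ P.period := by
      refine le_trans (Finset.card_le_card_of_forall_subsingleton
        (fun q w => (u, w, q) ∈ H) ?_ ?_) (card_div_eq_le (G := G) hτ hF.period_pos u
          (digit P.cell M.count u / P.period))
      · intro q hq
        simp only [R, U, Finset.mem_inter, Finset.mem_filter, Finset.mem_range] at hq
        rcases h.of_used u q hq.2.2 with ⟨w, hw, ht⟩ | ⟨w, hw⟩
        · have := (h.edge u w).1 ⟨q, hw⟩
          exact ⟨w, by simp [this.1, this.2.1, ht], hw⟩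
        · have := h.polarity _ _ _ hw
          rw [hs] at this
          have h2 := hq.1.2.1
          simp [h2] at this
      · rintro w - q ⟨-, hq⟩ q' ⟨-, hq'⟩
        exact h.eq_of_mem hq hq'
    have h2 : T.card ≤ P.period := by
      refine le_trans (Finset.card_le_card_of_forall_subsingleton
        (fun q w => (w, v, q) ∈ H) ?_ ?_) (hload v (edgeBlock G τ P ρ u v))
      · intro q hq
        obtain ⟨w, hw, hbw⟩ := hT q hq
        have := (h.edge w v).1 ⟨q, hw⟩
        exact ⟨w, by simp [this.1, this.2.1, hbw], hw⟩
      · rintro w - q ⟨-, hq⟩ q' ⟨-, hq'⟩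
        exact h.eq_of_mem hq hq'
    have h3 : R ⊆ R ∩ U ∪ T := by
      intro q hq
      have hq' := hq
      simp only [R, Finset.mem_filter, Finset.mem_range] at hq'
      have hn := hno q hq'.1
      simp only [Memory.Free, h.coin u huv, hc.cur, hc.coin, hq'.2.1, hq'.2.2, and_self,
        or_true, true_and, not_and_or] at hn
      simp only [U, T, Finset.mem_union, Finset.mem_inter, Finset.mem_filter, hq,
        Finset.mem_range, hq'.1, true_and]
      exact hn.imp digit_one_ne_zero.1 digit_one_ne_zero.1
    have h4 := (Finset.card_le_card h3).trans (Finset.card_union_le _ _)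
    omega

/-- A free position gives a color that differs from the colors of all adjacent edges. -/
theorem Invariant.color_ne (hτ : Function.Injective τ) {u v : Fin n} {q : ℕ}
    (h : Invariant G τ P ρ (τ v) l M H) (hc : CurrentInvariant G τ P ρ v M H)
    (hF : Fits G P ρ) (huv : τ u < τ v) (hl : u ∉ l)
    (hq : q < P.positions) (hfree : M.Free P u q) {e : Fin n × Fin n × ℕ} (he : e ∈ H)
    (heq : edgeColor G τ P ρ e = edgeColor G τ P ρ (u, v, q)) :
    e.1 ≠ u ∧ e.1 ≠ v ∧ e.2.1 ≠ u ∧ e.2.1 ≠ v := by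
  obtain ⟨u', v', q'⟩ := e
  have hb := h.block_eq huv hl
  have hq' := h.position_lt _ _ _ he
  have hpos : 0 < P.positions := by omega
  have hedge := (h.edge u' v').1 ⟨q', he⟩
  obtain ⟨hpol, hused, htaken⟩ := hfree
  have h1 := congrArg (· % P.positions) heq
  simp only [edgeColor, Nat.mul_add_mod_self_right, Nat.mod_eq_of_lt hq,
    Nat.mod_eq_of_lt hq'] at h1
  subst h1
  have hblock : edgeBlock G τ P ρ u' v' = edgeBlock G τ P ρ u v :=
    Nat.eq_of_mul_eq_mul_right hpos (Nat.add_right_cancel heq)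
  have hbit : digit 1 (digit P.cell M.used u) q' ≠ 1 := by omega
  have hv' : v' ≠ v := by
    rintro rfl
    have := hc.taken _ _ he
    rw [heq, edgeColor, ← hb] at this
    simp only at this
    omega
  refine ⟨?_, ?_, ?_, hv'⟩
  · -- Equal blocks mean equal periods, as no vertex visits a block twice.
    rintro rfl
    refine hbit (h.used_of_period _ _ _ he ?_)
    rw [h.count, if_neg hl, add_zero]
    have hlt : ∀ w, laterCount G τ u' (τ w) / P.period < 2 ^ P.shiftBits := fun w =>
      (Nat.div_le_div_right (laterCount_le G τ u' _)).trans_lt hF.blocks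
    have h2 : (ρ u' + laterCount G τ u' (τ v') / P.period) ≡
      (ρ u' + laterCount G τ u' (τ v) / P.period) [MOD 2 ^ P.shiftBits] := hblock
    exact Nat.ModEq.eq_of_lt_of_lt (Nat.ModEq.add_left_cancel' _ h2) (hlt v') (hlt v)
  · intro (h0 : u' = v)
    subst h0
    rcases hedge.2.2 with h2 | h2
    · exact absurd hedge.2.1 h2.not_gt
    · exact hv' (hτ h2.1)
  · intro (h0 : v' = u)
    subst h0
    rcases hpol with hs | hpol
    · exact hbit (h.used_of_small hs _ _ _ he)
    · rcases h.polarity _ _ _ he with hs | hpol'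
      · exact hbit (h.used_of_small hs _ _ _ he)
      · rw [h.coin _ huv] at hpol
        omega

theorem digit_setDigit_one (A i j : ℕ) :
    digit 1 (setDigit 1 A i 1) j = 1 ↔ i = j ∨ digit 1 A j = 1 := by
  rw [digit_setDigit A i j (by norm_num)]
  split_ifs with h <;> simp [h]

theorem Memory.digit_count_addEdge {u w : Fin n} (M : Memory)
    (h : digit P.cell M.count u + 1 < 2 ^ P.cell) :
    digit P.cell (M.addEdge P u).count w =
      if w = u then digit P.cell M.count u + 1 else digit P.cell M.count w := by
  simp only [Memory.addEdge]
  rw [digit_setDigit _ _ _ h]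
  simp [Fin.ext_iff, eq_comm]

theorem Memory.digit_used_addEdge {u v w : Fin n} (M : Memory) (hcur : M.cur = v)
    (hq : M.position P u < P.positions) (hP : P.positions ≤ P.cell)
    (hlt : ∀ w : Fin n, digit P.cell M.used w < 2 ^ (1 * P.positions)) :
    digit P.cell (M.addEdge P u).used w =
      if w = u then (if (digit P.cell M.count u + 1) % P.period = 0 then 0
        else setDigit 1 (digit P.cell M.used u) (M.position P u) 1)
      else if w = v then setDigit 1 (digit P.cell M.used v) (M.position P u) 1
      else digit P.cell M.used w := by
  have hS : ∀ w : Fin n, setDigit 1 (digit P.cell M.used w) (M.position P u) 1 < 2 ^ P.cell :=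
    fun w => (setDigit_lt _ (hlt w) hq).trans_le
      (Nat.pow_le_pow_right (by omega) (by rw [one_mul]; exact hP))
  simp only [Memory.addEdge]
  rw [digit_setDigit _ _ _ (by
    split_ifs
    · positivity
    · exact hS u), hcur, digit_setDigit _ _ _ (hS v)]
  simp only [Fin.val_inj, eq_comm]

set_option maxHeartbeats 800000 in
/-- Coloring an edge preserves the invariants. -/
theorem Invariant.addEdge (hτ : Function.Injective τ) {u v : Fin n}
    (h : Invariant G τ P ρ (τ v) l M H) (hc : CurrentInvariant G τ P ρ v M H)
    (hF : Fits G P ρ) (hL : Lucky G τ P ρ) (hadj : G.Adj u v) (huv : τ u < τ v) (hl : u ∉ l)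
    (hq : M.position P u < P.positions) (hfree : M.Free P u (M.position P u)) :
    Invariant G τ P ρ (τ v) (l ++ [u]) (M.addEdge P u) (H ++ [(u, v, M.position P u)]) ∧
      CurrentInvariant G τ P ρ v (M.addEdge P u) (H ++ [(u, v, M.position P u)]) := by
  have hcol := h.color_eq huv hl
  have hne := fun e he heq => h.color_ne hτ hc hF huv hl hq hfree (e := e) he heq
  set q := M.position P u with hqdef
  have hnotin : ∀ w q', (u, w, q') ∈ H → τ w < τ v := by
    intro w q' hw
    rcases ((h.edge u w).1 ⟨q', hw⟩).2.2 with h1 | h1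
    · exact h1
    · exact absurd h1.2 hl
  have hcur : M.cur = v := hc.cur
  have hcount := fun w => M.digit_count_addEdge (P := P) (u := u) (w := w) (by
    have h1 := laterCount_lt G τ hadj huv (Nat.lt_succ_self (τ v))
    have h2 := laterCount_le G τ u (τ v).succ
    have h3 := hF.degree_lt
    rw [h.count, if_neg hl]
    omega)
  have hS : ∀ w : Fin n, setDigit 1 (digit P.cell M.used w) q 1 < 2 ^ (1 * P.positions) :=
    fun w => setDigit_lt _ (h.used_lt w) hq
  have hused := fun w => M.digit_used_addEdge (u := u) (w := w) hcur hq hF.positions_le h.used_lt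
  set c := digit P.cell M.count u with hcdef
  have hc_eq : c = laterCount G τ u (τ v) := by rw [hcdef, h.count, if_neg hl, add_zero]
  have hc_lt : c + 1 ≤ G.maxDegree := by
    have h1 := laterCount_lt G τ hadj huv (Nat.lt_succ_self (τ v))
    have h2 := laterCount_le G τ u (τ v).succ
    omega
  have hvu : v ≠ u := by rintro rfl; omega
  have hdvd : (c + 1) % P.period = 0 → (c + 1) / P.period = c / P.period + 1 := fun h0 => by
    rw [Nat.succ_div, if_pos (Nat.dvd_of_mod_eq_zero h0)]
  have hndvd : (c + 1) % P.period ≠ 0 → (c + 1) / P.period = c / P.period := fun h0 => by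
    rw [Nat.succ_div, if_neg fun hd => h0 (Nat.mod_eq_zero_of_dvd hd), add_zero]
  have hsmall : P.small = true → (c + 1) % P.period ≠ 0 := fun hs => by
    rcases hL with ⟨-, -, h1⟩ | ⟨h1, -⟩
    · rw [Nat.mod_eq_of_lt (by omega)]
      omega
    · simp [h1] at hs
  have hbit_u : ∀ x, digit 1 (digit P.cell (M.addEdge P u).used u) x = 1 ↔
      (c + 1) % P.period ≠ 0 ∧ (q = x ∨ digit 1 (digit P.cell M.used u) x = 1) := fun x => by
    rw [hused, if_pos rfl]
    split_ifs with h0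
    · simp [digit_zero, h0]
    · rw [digit_setDigit_one]
      tauto
  have hbit_v : ∀ x, digit 1 (digit P.cell (M.addEdge P u).used v) x = 1 ↔
      q = x ∨ digit 1 (digit P.cell M.used v) x = 1 := fun x => by
    rw [hused, if_neg hvu, if_pos rfl, digit_setDigit_one]
  have hbit : ∀ w, w ≠ u → ∀ x, digit 1 (digit P.cell M.used w) x = 1 →
      digit 1 (digit P.cell (M.addEdge P u).used w) x = 1 := fun w hw x hx => by
    rcases eq_or_ne w v with rfl | hwv
    · exact (hbit_v x).2 (.inr hx)
    · rwa [hused, if_neg hw, if_neg hwv]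
  refine ⟨⟨h.coin, fun w => ?_, fun w => ?_, ?_, fun w x => ?_, fun w x q' hw => ?_,
    fun w x q' hw => ?_, fun w x q' hw hlc => ?_, fun hs w x q' hw => ?_, fun w x hx => ?_, ?_⟩,
    hcur, hc.coin, fun w q' hw => ?_, fun x hx => ?_⟩
  · rw [hcount]
    split_ifs with h1 h2 h2
    · rw [h1, hc_eq]
    · simp [h1] at h2
    · rw [h.count, if_pos (by simpa [h1] using h2)]
    · rw [h.count, if_neg (by simpa [h1] using h2)]
  · rw [hused]
    split_ifs
    · positivity
    · exact hS u
    · exact hS v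
    · exact h.used_lt w
  · rw [List.map_append, List.nodup_append']
    refine ⟨h.nodup, by simp, ?_⟩
    simp only [List.disjoint_left, List.mem_map, List.map_cons, List.map_nil, List.mem_singleton]
    rintro _ ⟨⟨w, x, q'⟩, he, rfl⟩ heq
    simp only [Prod.mk.injEq] at heq
    obtain ⟨rfl, rfl⟩ := heq
    exact (hnotin _ _ he).false
  · have h1 := h.edge w x
    simp only [List.mem_append, List.mem_singleton, Prod.mk.injEq, exists_or, h1]
    constructor
    · rintro (h1 | ⟨q', rfl, rfl, -⟩)
      · tauto
      · exact ⟨hadj, huv, .inr ⟨rfl, .inr rfl⟩⟩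
    · rintro ⟨h2, h3, h4 | ⟨h4, h5 | rfl⟩⟩
      · tauto
      · tauto
      · exact .inr ⟨q, rfl, hτ h4, rfl⟩
  · simp only [List.mem_append, List.mem_singleton, Prod.mk.injEq] at hw
    rcases hw with hw | ⟨rfl, rfl, rfl⟩
    · exact h.position_lt _ _ _ hw
    · exact hq
  · simp only [List.mem_append, List.mem_singleton, Prod.mk.injEq] at hw
    rcases hw with hw | ⟨rfl, rfl, rfl⟩
    · exact h.polarity _ _ _ hw
    · have := hfree.1
      rwa [hcur, hc.coin, h.coin w huv] at this
  · simp only [List.mem_append, List.mem_singleton, Prod.mk.injEq] at hw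
    rw [hcount] at hlc
    rcases hw with hw | ⟨rfl, rfl, rfl⟩
    · split_ifs at hlc with h1
      · subst h1
        -- A new period would separate the old edges of `u` from its next ones.
        have h2 : laterCount G τ w (τ x) / P.period ≤ c / P.period :=
          Nat.div_le_div_right (by
            rw [hc_eq]; exact laterCount_mono G τ w (hnotin _ _ hw).le)
        have h3 : (c + 1) % P.period ≠ 0 := fun h0 => by have := hdvd h0; omega
        rw [hndvd h3] at hlc
        exact (hbit_u _).2 ⟨h3, .inr (h.used_of_period _ _ _ hw hlc)⟩
      · exact hbit w h1 _ (h.used_of_period _ _ _ hw hlc)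
    · rw [if_pos rfl, ← hc_eq] at hlc
      have h3 : (c + 1) % P.period ≠ 0 := fun h0 => by have := hdvd h0; omega
      exact (hbit_u _).2 ⟨h3, .inl rfl⟩
  · simp only [List.mem_append, List.mem_singleton, Prod.mk.injEq] at hw
    rcases hw with hw | ⟨rfl, rfl, rfl⟩
    · rcases eq_or_ne x u with rfl | hxu
      · exact (hbit_u _).2 ⟨hsmall hs, .inr (h.used_of_small hs _ _ _ hw)⟩
      · exact hbit x hxu _ (h.used_of_small hs _ _ _ hw)
    · exact (hbit_v _).2 (.inl rfl)
  · rw [hcount]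
    simp only [List.mem_append, List.mem_singleton, Prod.mk.injEq]
    rcases eq_or_ne w u with rfl | hwu
    · obtain ⟨h3, hx⟩ := (hbit_u x).1 hx
      rw [if_pos rfl, hndvd h3]
      rcases hx with rfl | hx
      · exact .inl ⟨v, .inr ⟨rfl, rfl, rfl⟩, by rw [hc_eq]⟩
      · rcases h.of_used _ _ hx with ⟨y, hy, hlc⟩ | ⟨y, hy⟩
        · exact .inl ⟨y, .inl hy, hlc⟩
        · exact .inr ⟨y, .inl hy⟩
    · rw [if_neg hwu]
      have hx' : (w = v ∧ q = x) ∨ digit 1 (digit P.cell M.used w) x = 1 := by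
        rcases eq_or_ne w v with rfl | hwv
        · exact ((hbit_v x).1 hx).imp_left fun h => ⟨rfl, h⟩
        · rw [hused, if_neg hwu, if_neg hwv] at hx
          exact .inr hx
      rcases hx' with ⟨rfl, rfl⟩ | hx
      · exact .inr ⟨u, .inr ⟨rfl, rfl, rfl⟩⟩
      · rcases h.of_used _ _ hx with ⟨y, hy, hlc⟩ | ⟨y, hy⟩
        · exact .inl ⟨y, .inl hy, hlc⟩
        · exact .inr ⟨y, .inl hy⟩
  · intro e he e' he' hee' heq
    simp only [List.mem_append, List.mem_singleton] at he he'
    rcases he with he | rfl <;> rcases he' with he' | rfl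
    · exact h.proper e he e' he' hee' heq
    · obtain ⟨h1, h2, h3, h4⟩ := hne e he heq
      exact ⟨h1, h2, h3, h4⟩
    · obtain ⟨h1, h2, h3, h4⟩ := hne e' he' heq.symm
      exact ⟨h1.symm, h3.symm, h2.symm, h4.symm⟩
    · exact absurd rfl hee'
  · simp only [List.mem_append, List.mem_singleton, Prod.mk.injEq, true_and] at hw
    simp only [Memory.addEdge]
    rw [digit_setDigit_one, hcol]
    rcases hw with hw | ⟨rfl, rfl⟩
    · exact .inr (hc.taken _ _ hw)
    · exact .inl rfl
  · simp only [Memory.addEdge] at hx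
    rw [digit_setDigit_one, hcol] at hx
    rcases hx with rfl | hx
    · exact ⟨u, q, by simp, rfl⟩
    · obtain ⟨w, q', hw, hx⟩ := hc.of_taken x hx
      exact ⟨w, q', by simp [hw], hx⟩

end Correctness

section Correctness

variable {n : ℕ} {G : SimpleGraph (Fin n)} [DecidableRel G.Adj] {τ : Fin n → ℕ}
  {P : Params} {ρ : Fin n → ℕ} {l : List (Fin n)} {M : Memory} {H : List (Fin n × Fin n × ℕ)}

variable (G τ P ρ) in
/-- The record that reports the color of an edge. -/
def edgeRecord (e : Fin n × Fin n × ℕ) : Record := (e.1, e.2.1, edgeColor G τ P ρ e)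

/-- The tokens that give edges from `v` to the vertices in `l'`. -/
theorem Invariant.addEdges (hτ : Function.Injective τ) {v : Fin n} (hF : Fits G P ρ)
    (hL : Lucky G τ P ρ) (l' : List (Fin n)) (h : Invariant G τ P ρ (τ v) l M H)
    (hc : CurrentInvariant G τ P ρ v M H) (hl' : ∀ u ∈ l', G.Adj u v ∧ τ u < τ v)
    (hnd : (l ++ l').Nodup) (Z : List (Token n × ℕ)) (hZ : Z.map Prod.fst = l'.map Token.nbr) :
    ∃ H', records P M Z = H'.map (edgeRecord G τ P ρ) ∧
      Invariant G τ P ρ (τ v) (l ++ l') (memoryAfter P M Z) (H ++ H') ∧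
      CurrentInvariant G τ P ρ v (memoryAfter P M Z) (H ++ H') := by
  induction l' generalizing l M H Z with
  | nil =>
    obtain rfl : Z = [] := by simpa using hZ
    exact ⟨[], rfl, by simpa [memoryAfter] using h, by simpa [memoryAfter] using hc⟩
  | cons u l' ih =>
    rw [List.map_cons, List.map_eq_cons_iff] at hZ
    obtain ⟨⟨t, r⟩, Z, rfl, ht, hZ⟩ := hZ
    obtain rfl : t = Token.nbr u := ht
    obtain ⟨hadj, huv⟩ := hl' u (by simp)
    have hu : u ∉ l := fun hu =>
      (List.nodup_append'.1 hnd).2.2 hu (by simp)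
    obtain ⟨hq, hfree⟩ := leastBelow_spec _ (h.exists_free hτ hc hF hL huv hu)
    have hq' : M.position P u < P.positions := hq
    have hstep : M.step P (Token.nbr u).toNat r = M.addEdge P u := by
      simp [Memory.step, Token.toNat, hq']
    have hout : (decodeRecord (M.output P (Token.nbr u).toNat)).toList =
        [edgeRecord G τ P ρ (u, v, M.position P u)] := by
      simp [Memory.output, Token.toNat, decodeRecord, edgeRecord, hc.cur,
        h.color_eq huv hu]
    obtain ⟨h', hc'⟩ := h.addEdge hτ hc hF hL hadj huv hu hq' hfree
    obtain ⟨H', h1, h2, h3⟩ := ih h' hc' (fun w hw => hl' w (by simp [hw])) (by simpa using hnd)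
      Z hZ
    refine ⟨(u, v, M.position P u) :: H', ?_, ?_, ?_⟩
    · simp only [records, hout, hstep, h1, List.map_cons, List.singleton_append]
    · simpa [memoryAfter, hstep] using h2
    · simpa [memoryAfter, hstep] using h3

/-- The rest of the stream from the arrival at time `i` on. -/
theorem Invariant.finish {π : Equiv.Perm (Fin n)} {back : Fin n → List (Fin n)}
    (hback : IsBackLists G π back) {P : Params} {ρ : Fin n → ℕ} (hF : Fits G P ρ)
    (hL : Lucky G (fun v => (π.symm v : ℕ)) P ρ) {k i : ℕ} (hk : i + k = n)
    (h : Invariant G (fun v => (π.symm v : ℕ)) P ρ i [] M H) (Z : List (Token n × ℕ))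
    (hZ : Z.map Prod.fst = ((List.ofFn fun i : Fin n =>
      Token.arrive (π i) :: (back (π i)).map Token.nbr).drop i).flatten ++ [Token.eos])
    (hρ : ∀ v r, (Token.arrive v, r) ∈ Z → r = ρ v) :
    ∃ H' M', records P M Z = H'.map (edgeRecord G (fun v => (π.symm v : ℕ)) P ρ) ∧
      Invariant G (fun v => (π.symm v : ℕ)) P ρ n [] M' (H ++ H') := by
  have hτ : Function.Injective fun v => (π.symm v : ℕ) :=
    fun v w h => π.symm.injective (Fin.ext h)
  induction k generalizing i M H Z with
  | zero =>
    obtain rfl : i = n := by omega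
    rw [List.drop_eq_nil_of_le (by simp), List.flatten_nil, List.nil_append,
      List.map_eq_singleton_iff] at hZ
    obtain ⟨⟨t, r⟩, rfl, ht⟩ := hZ
    obtain rfl : t = Token.eos := ht
    exact ⟨[], M, by simp [records, Memory.output, Token.toNat, decodeRecord], by simpa using h⟩
  | succ k ih =>
    have hi : i < n := by omega
    rw [List.drop_eq_getElem_cons (by simpa using hi), List.flatten_cons, List.append_assoc,
      List.getElem_ofFn, List.cons_append, List.map_eq_cons_iff] at hZ
    obtain ⟨⟨t, r⟩, Z, rfl, ht, hZ⟩ := hZ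
    set v := π ⟨i, hi⟩ with hv
    obtain rfl : t = Token.arrive v := ht
    obtain rfl := hρ v r (by simp)
    rw [List.map_eq_append_iff] at hZ
    obtain ⟨Z₁, Z₂, rfl, hZ₁, hZ₂⟩ := hZ
    have hvi : (π.symm v : ℕ) = i := by simp [hv]
    clear_value v
    subst hvi
    have hstep : M.step P (Token.arrive v).toNat (ρ v) = M.arrive P v (ρ v) := by
      have h1 : (2 * (v : ℕ) + 1) / 2 = v := by omega
      simp [Memory.step, Token.toNat, h1, Nat.add_mod]
    have hout : decodeRecord (M.output P (Token.arrive v).toNat) = none := by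
      simp [Memory.output, Token.toNat, decodeRecord, Nat.add_mod]
    obtain ⟨h', hc⟩ := h.arrive (v := v) rfl (hF.coin_lt v)
    have hmem : ∀ u, u ∈ back v ↔ G.Adj v u ∧ (π.symm u : ℕ) < π.symm v := (hback v).2
    obtain ⟨H₁, h1, h2, h3⟩ := h'.addEdges hτ hF hL (back v) hc
      (fun u hu => ⟨((hmem u).1 hu).1.symm, ((hmem u).1 hu).2⟩)
      (by simpa using (hback v).1) Z₁ hZ₁
    rw [List.nil_append] at h2
    obtain ⟨H₂, M', h4, h5⟩ := ih (by omega) (h2.next hτ h3 hmem) Z₂ hZ₂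
      (fun w r hw => hρ w r (by simp [hw]))
    refine ⟨H₁ ++ H₂, M', ?_, by simpa using h5⟩
    simp only [records, hout, hstep, Option.toList_none, List.nil_append, records_append, h1, h4,
      List.map_append]

/-- In the end the records report a proper edge coloring. -/
theorem Invariant.reports (hτ : Function.Injective τ) {i K : ℕ} (hi : ∀ v, τ v < i)
    (h : Invariant G τ P ρ i l M H) (hK : 0 < G.maxDegree → 2 ^ P.shiftBits * P.positions ≤ K) :
    ReportsEdgeColoring G K (H.map (edgeRecord G τ P ρ)) := by
  have hlt : ∀ e ∈ H, edgeColor G τ P ρ e < K := fun ⟨u, v, q⟩ he =>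
    lt_of_lt_of_le (Nat.lt_succ_self _)
      ((P.block_mul_add_le _ _ (h.position_lt _ _ _ he)).trans (hK
        (((G.degree_pos_iff_exists_adj u).2 ⟨v, ((h.edge u v).1 ⟨q, he⟩).1⟩).trans_le
          (G.degree_le_maxDegree u))))
  have hex : ∀ e : G.edgeSet, ∃ f ∈ H, s(f.1, f.2.1) = (e : Sym2 (Fin n)) := by
    rintro ⟨e, he⟩
    induction e using Sym2.ind with
    | _ a b =>
      have hab : G.Adj a b := he
      rcases lt_trichotomy (τ a) (τ b) with h1 | h1 | h1
      · obtain ⟨q, hq⟩ := (h.edge a b).2 ⟨hab, h1, .inl (hi b)⟩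
        exact ⟨_, hq, rfl⟩
      · exact absurd (hτ h1) hab.ne
      · obtain ⟨q, hq⟩ := (h.edge b a).2 ⟨hab.symm, h1, .inl (hi a)⟩
        exact ⟨_, hq, Sym2.eq_swap⟩
  have huniq : ∀ f ∈ H, ∀ f' ∈ H, s(f.1, f.2.1) = s(f'.1, f'.2.1) → f = f' := by
    rintro ⟨u, v, q⟩ hf ⟨u', v', q'⟩ hf' heq
    rcases Sym2.eq_iff.1 heq with ⟨h1, h2⟩ | ⟨h1, h2⟩
    · simp only at h1 h2
      subst h1 h2
      rw [h.eq_of_mem hf hf']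
    · simp only at h1 h2
      subst h1 h2
      have h1 := ((h.edge _ _).1 ⟨_, hf⟩).2.1
      have h2 := ((h.edge _ _).1 ⟨_, hf'⟩).2.1
      omega
  choose f hfH hf using hex
  refine ⟨SimpleGraph.Coloring.mk (fun e => ⟨edgeColor G τ P ρ (f e), hlt _ (hfH e)⟩) ?_, ?_, ?_⟩
  · intro e e' hadj heq
    obtain ⟨hne, x, hx, hx'⟩ := SimpleGraph.lineGraph_adj_iff_exists.1 hadj
    have hff : f e ≠ f e' := fun h0 => hne (Subtype.ext (by rw [← hf e, ← hf e', h0]))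
    obtain ⟨h1, h2, h3, h4⟩ := h.proper _ (hfH e) _ (hfH e') hff (Fin.mk.inj_iff.1 heq)
    rw [← hf e, Sym2.mem_iff] at hx
    rw [← hf e', Sym2.mem_iff] at hx'
    rcases hx with rfl | rfl <;> rcases hx' with hx' | hx'
    · exact h1 hx'
    · exact h2 hx'
    · exact h3 hx'
    · exact h4 hx'
  · intro r hr
    obtain ⟨⟨u, v, q⟩, he, rfl⟩ := List.mem_map.1 hr
    have hadj := ((h.edge u v).1 ⟨q, he⟩).1
    refine ⟨u, v, hadj, ?_⟩
    have h1 : f ⟨s(u, v), hadj⟩ = (u, v, q) := huniq _ (hfH _) _ he (hf ⟨s(u, v), hadj⟩)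
    change _ = ((u : ℕ), (v : ℕ), edgeColor G τ P ρ (f ⟨s(u, v), hadj⟩))
    rw [h1]
    rfl
  · intro u v huv
    obtain ⟨e, heH, hes⟩ : ∃ e ∈ H, s(e.1, e.2.1) = s(u, v) :=
      ⟨_, hfH ⟨s(u, v), huv⟩, hf ⟨s(u, v), huv⟩⟩
    have hval : ∀ a b c d : Fin n, s((a : ℕ), (b : ℕ)) = s((c : ℕ), (d : ℕ)) ↔ s(a, b) = s(c, d) :=
      fun a b c d => by simp only [Sym2.eq_iff, Fin.val_inj]
    rw [List.countP_map, ← List.count_eq_one_of_mem h.nodup.of_map heH, List.count]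
    refine List.countP_congr fun x hx => ?_
    simp only [Function.comp_apply, edgeRecord, decide_eq_true_eq, beq_iff_eq, hval, ← hes]
    exact ⟨fun h0 => huniq _ hx _ heH h0, fun h0 => by rw [h0]⟩

end Correctness

/-- If the random bits that are drawn at the arrivals of the vertices are lucky, then the records
printed on a vertex-arrival stream report a proper edge coloring. -/
theorem reports_records {n K : ℕ} {G : SimpleGraph (Fin n)} [DecidableRel G.Adj]
    {π : Equiv.Perm (Fin n)} {back : Fin n → List (Fin n)} (hback : IsBackLists G π back)
    {P : Params} {ρ : Fin n → ℕ} (hF : Fits G P ρ)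
    (hL : Lucky G (fun v => (π.symm v : ℕ)) P ρ) (hK : 0 < G.maxDegree → 2 ^ P.shiftBits * P.positions ≤ K)
    (Z : List (Token n × ℕ)) (hZ : Z.map Prod.fst = vertexStream π back)
    (hρ : ∀ v r, (Token.arrive v, r) ∈ Z → r = ρ v) :
    ReportsEdgeColoring G K (records P ⟨0, 0, 0, 0, 0⟩ Z) := by
  obtain ⟨H, M, h1, h2⟩ := Invariant.zero.finish hback hF hL (Nat.zero_add n) Z hZ hρ
  rw [h1]
  exact h2.reports (fun v w h => π.symm.injective (Fin.ext h)) (fun v => (π.symm v).2) hK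

/-! ### Probability estimates -/

section Counting

variable {ι : Type} [Fintype ι] [DecidableEq ι]

/-- Two different coordinates of a uniformly random function are independent and uniform. -/
theorem card_pair_mul {m : ℕ} {i j : ι} (hij : i ≠ j) (B : Fin m → Fin m → Prop)
    [∀ x y, Decidable (B x y)] :
    (Finset.univ.filter fun ω : ι → Fin m => B (ω i) (ω j)).card * (m * m) =
      (Finset.univ.filter fun z : Fin m × Fin m => B z.1 z.2).card * m ^ Fintype.card ι := by
  let t : Fin m → ι → Finset (Fin m) := fun y k =>
    if k = i then Finset.univ.filter (fun x => B x y) else if k = j then {y} else Finset.univ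
  have h1 : (Finset.univ.filter fun ω : ι → Fin m => B (ω i) (ω j)).card =
      ∑ y, (Fintype.piFinset (t y)).card := by
    rw [Finset.card_eq_sum_card_fiberwise (f := fun ω => ω j) (t := Finset.univ) (by simp)]
    refine Finset.sum_congr rfl fun y _ => congrArg Finset.card ?_
    ext ω
    simp only [Finset.mem_filter, Finset.mem_univ, true_and, Fintype.mem_piFinset, t]
    constructor
    · rintro ⟨h1, rfl⟩ k
      split_ifs with h2 h3
      · subst h2; simpa using h1
      · subst h3; simp
      · simp
    · intro h
      have h1 := h i
      have h2 := h j
      simp only [if_true, if_neg hij.symm, Finset.mem_filter, Finset.mem_univ, true_and,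
        Finset.mem_singleton] at h1 h2
      exact ⟨by rw [h2]; exact h1, h2⟩
  have h2 : ∀ y, (Fintype.piFinset (t y)).card * (m * m) =
      (Finset.univ.filter fun x => B x y).card * m ^ Fintype.card ι := by
    intro y
    have hj : j ∈ Finset.univ.erase i := by simp [hij.symm]
    have h3 : ∏ k ∈ (Finset.univ.erase i).erase j, (t y k).card =
        ∏ k ∈ (Finset.univ.erase i).erase j, m :=
      Finset.prod_congr rfl fun k hk => by
        simp only [Finset.mem_erase, Finset.mem_univ, and_true] at hk
        simp [t, hk.1, hk.2]
    have h4 : m ^ Fintype.card ι = m * (m * ∏ k ∈ (Finset.univ.erase i).erase j, m) := by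
      rw [Finset.mul_prod_erase _ (fun _ => m) hj, Finset.mul_prod_erase _ (fun _ => m)
        (Finset.mem_univ i), Finset.prod_const, Finset.card_univ]
    rw [Fintype.card_piFinset, ← Finset.mul_prod_erase _ _ (Finset.mem_univ i),
      ← Finset.mul_prod_erase _ _ hj, h3, h4]
    simp only [t, if_true, if_neg hij.symm, Finset.card_singleton]
    ring
  have h3 : (Finset.univ.filter fun z : Fin m × Fin m => B z.1 z.2).card =
      ∑ y, (Finset.univ.filter fun x => B x y).card := by
    simp only [Finset.card_filter]
    rw [Fintype.sum_prod_type, Finset.sum_comm]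
  rw [h1, h3, Finset.sum_mul, Finset.sum_mul]
  exact Finset.sum_congr rfl fun y _ => h2 y

end Counting

theorem digit_one_of_lt {x m : ℕ} (h : x < 2 ^ m) : digit 1 x m = 0 := by
  simp [digit, Nat.div_eq_of_lt h]

theorem digit_one_two_pow_add {x m : ℕ} (h : x < 2 ^ m) : digit 1 (2 ^ m + x) m = 1 := by
  simp [digit, Nat.add_div_left _ (show 0 < 2 ^ m by positivity), Nat.div_eq_of_lt h]

theorem digit_one_two_pow_add_of_lt {x m j : ℕ} (h : x < 2 ^ m) (hj : j < m) :
    digit 1 (2 ^ m + x) j = digit 1 x j := by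
  rw [← digit_mod hj, one_mul, Nat.add_mod_left, Nat.mod_eq_of_lt h]

/-- The exponential moment of the number of positions where two random bit strings do not have the
bits `0` and `1`, respectively. -/
theorem sum_prod_bits (a m : ℕ) :
    ∑ x ∈ Finset.range (2 ^ (a + m)), ∑ y ∈ Finset.range (2 ^ (a + m)),
      ∏ q ∈ Finset.range m, (if digit 1 x (a + q) = 0 ∧ digit 1 y (a + q) = 1 then 1 else 2) =
      4 ^ a * 7 ^ m := by
  induction m with
  | zero =>
    simp
    rw [← mul_pow]; norm_num
  | succ m ih =>
    have hstep : ∀ x < 2 ^ (a + m), ∀ y < 2 ^ (a + m), ∀ x' ∈ ({x, 2 ^ (a + m) + x} : Finset ℕ),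
        ∀ y' ∈ ({y, 2 ^ (a + m) + y} : Finset ℕ),
        ∏ q ∈ Finset.range m,
          (if digit 1 x' (a + q) = 0 ∧ digit 1 y' (a + q) = 1 then 1 else 2) =
        ∏ q ∈ Finset.range m,
          (if digit 1 x (a + q) = 0 ∧ digit 1 y (a + q) = 1 then 1 else 2) := by
      intro x hx y hy x' hx' y' hy'
      refine Finset.prod_congr rfl fun q hq => ?_
      have hq' : a + q < a + m := by have := Finset.mem_range.1 hq; omega
      simp only [Finset.mem_insert, Finset.mem_singleton] at hx' hy'
      have h1 : digit 1 x' (a + q) = digit 1 x (a + q) := by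
        rcases hx' with rfl | rfl
        · rfl
        · exact digit_one_two_pow_add_of_lt hx hq'
      have h2 : digit 1 y' (a + q) = digit 1 y (a + q) := by
        rcases hy' with rfl | rfl
        · rfl
        · exact digit_one_two_pow_add_of_lt hy hq'
      rw [h1, h2]
    rw [← add_assoc, show 2 ^ (a + m + 1) = 2 ^ (a + m) + 2 ^ (a + m) by ring, pow_succ 7,
      ← mul_assoc, ← ih, Finset.sum_mul, Finset.sum_range_add, ← Finset.sum_add_distrib]
    refine Finset.sum_congr rfl fun x hx => ?_
    rw [Finset.sum_mul, Finset.sum_range_add, Finset.sum_range_add, ← Finset.sum_add_distrib,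
      ← Finset.sum_add_distrib, ← Finset.sum_add_distrib]
    refine Finset.sum_congr rfl fun y hy => ?_
    rw [Finset.mem_range] at hx hy
    simp only [Finset.prod_range_succ]
    rw [hstep x hx y hy x (by simp) (2 ^ (a + m) + y) (by simp),
      hstep x hx y hy (2 ^ (a + m) + x) (by simp) y (by simp),
      hstep x hx y hy (2 ^ (a + m) + x) (by simp) (2 ^ (a + m) + y) (by simp),
      digit_one_of_lt hx, digit_one_of_lt hy, digit_one_two_pow_add hx, digit_one_two_pow_add hy]
    simp
    ring

/-- Two random strings of `16 * h` bits have few positions with bits `0` and `1`, respectively, only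
with probability at most `2 ^ (-h)`. -/
theorem card_few_positions (a h : ℕ) :
    (Finset.univ.filter fun z : Fin (2 ^ (a + 16 * h)) × Fin (2 ^ (a + 16 * h)) =>
      ((Finset.range (16 * h)).filter fun q =>
        digit 1 z.1 (a + q) = 0 ∧ digit 1 z.2 (a + q) = 1).card ≤ 2 * h).card * 2 ^ h ≤
      2 ^ (a + 16 * h) * 2 ^ (a + 16 * h) := by
  set B := Finset.univ.filter fun z : Fin (2 ^ (a + 16 * h)) × Fin (2 ^ (a + 16 * h)) =>
      ((Finset.range (16 * h)).filter fun q =>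
        digit 1 z.1 (a + q) = 0 ∧ digit 1 z.2 (a + q) = 1).card ≤ 2 * h with hB
  have h1 : B.card * 2 ^ (14 * h) ≤ 4 ^ a * 7 ^ (16 * h) := by
    rw [← sum_prod_bits, Finset.sum_range, ← smul_eq_mul, ← Finset.sum_const]
    simp_rw [Finset.sum_range]
    rw [← Fintype.sum_prod_type' (f := fun x y : Fin (2 ^ (a + 16 * h)) =>
      ∏ q ∈ Finset.range (16 * h),
        (if digit 1 x (a + q) = 0 ∧ digit 1 y (a + q) = 1 then 1 else 2))]
    refine (Finset.sum_le_sum fun z hz => ?_).trans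
      (Finset.sum_le_sum_of_subset (Finset.subset_univ B))
    simp only [hB, Finset.mem_filter, Finset.mem_univ, true_and] at hz
    rw [Finset.prod_ite, Finset.prod_const_one, Finset.prod_const, one_mul]
    refine Nat.pow_le_pow_right (by omega) ?_
    have := Finset.card_filter_add_card_filter_not (s := Finset.range (16 * h))
      (fun q => digit 1 z.1 (a + q) = 0 ∧ digit 1 z.2 (a + q) = 1)
    rw [Finset.card_range] at this
    omega
  have h2 : 7 ^ (16 * h) ≤ 2 ^ (45 * h) := by
    rw [pow_mul, pow_mul]
    exact Nat.pow_le_pow_left (by norm_num) h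
  have h3 : B.card * 2 ^ h * 2 ^ (13 * h) ≤ 2 ^ (a + 16 * h) * 2 ^ (a + 16 * h) * 2 ^ (13 * h) := by
    calc B.card * 2 ^ h * 2 ^ (13 * h) = B.card * 2 ^ (14 * h) := by ring
      _ ≤ 4 ^ a * 2 ^ (45 * h) := h1.trans (Nat.mul_le_mul_left _ h2)
      _ = _ := by rw [show 4 = 2 ^ 2 by norm_num, ← pow_mul]; ring
  exact Nat.le_of_mul_le_mul_right h3 (by positivity)

theorem card_add_mod_eq_le (a p t b : ℕ) :
    (Finset.univ.filter fun x : Fin (2 ^ (a + p)) => (x + t) % 2 ^ a = b).card ≤ 2 ^ p := by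
  rw [← Finset.card_range (2 ^ p)]
  refine Finset.card_le_card_of_injOn (fun x => (x : ℕ) / 2 ^ a) (fun x _ => ?_) ?_
  · simp only [Finset.coe_range, Set.mem_Iio]
    rw [Nat.div_lt_iff_lt_mul (by positivity), ← pow_add, add_comm p]
    exact x.2
  · intro x hx y hy hxy
    simp only [Finset.coe_filter, Finset.mem_univ, true_and, Set.mem_ofPred_eq] at hx hy hxy
    have h1 : (x + t) ≡ (y + t) [MOD 2 ^ a] := hx.trans hy.symm
    have h2 : (x : ℕ) % 2 ^ a = y % 2 ^ a := Nat.ModEq.add_right_cancel' t h1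
    rw [Fin.ext_iff, ← Nat.div_add_mod (x : ℕ) (2 ^ a), ← Nat.div_add_mod (y : ℕ) (2 ^ a), hxy, h2]

section Counting

variable {ι : Type} [Fintype ι] [DecidableEq ι]

/-- A Chernoff bound: if at most `d` vertices choose one of `2 ^ a` blocks each, and `2 ^ a` is at
least `8 * d / h`, then more than `h` choose the same block `b` only with probability at
most `2 ^ (-h)`. -/
theorem card_overload_le (a p : ℕ) {h d : ℕ} (hd : 8 * d ≤ h * 2 ^ a) (S : Finset ι)
    (hS : S.card ≤ d) (t : ι → ℕ) (b : ℕ) :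
    (Finset.univ.filter fun ω : ι → Fin (2 ^ (a + p)) =>
      h < (S.filter fun k => (ω k + t k) % 2 ^ a = b).card).card * 2 ^ h ≤
      (2 ^ (a + p)) ^ Fintype.card ι := by
  set B := Finset.univ.filter fun ω : ι → Fin (2 ^ (a + p)) =>
      h < (S.filter fun k => (ω k + t k) % 2 ^ a = b).card with hB
  let g : ι → Fin (2 ^ (a + p)) → ℕ := fun k x =>
    if k ∈ S then (if (x + t k) % 2 ^ a = b then 4 else 1) else 1
  have h1 : B.card * 4 ^ h ≤ ∏ k, ∑ x, g k x := by
    rw [Finset.prod_univ_sum, Fintype.piFinset_univ, ← smul_eq_mul, ← Finset.sum_const]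
    refine (Finset.sum_le_sum fun ω hω => ?_).trans
      (Finset.sum_le_sum_of_subset (Finset.subset_univ B))
    simp only [hB, Finset.mem_filter, Finset.mem_univ, true_and] at hω
    simp only [g]
    rw [Finset.prod_ite, Finset.prod_const_one, mul_one, Finset.filter_mem_eq_inter,
      Finset.univ_inter, Finset.prod_ite, Finset.prod_const_one, mul_one, Finset.prod_const]
    exact Nat.pow_le_pow_right (by omega) hω.le
  have h2 : ∀ k, ((∑ x, g k x : ℕ) : ℝ) ≤
      2 ^ (a + p) * (if k ∈ S then Real.exp (3 / 2 ^ a) else 1) := by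
    intro k
    by_cases hk : k ∈ S
    · have h3 := card_add_mod_eq_le a p (t k) b
      have h4 : ∑ x, g k x = 2 ^ (a + p) +
          3 * (Finset.univ.filter fun x : Fin (2 ^ (a + p)) => (x + t k) % 2 ^ a = b).card := by
        have h5 : ∀ x, g k x = 1 + 3 * if (x + t k) % 2 ^ a = b then 1 else 0 := fun x => by
          simp only [g, if_pos hk]
          split_ifs <;> rfl
        simp only [h5, Finset.sum_add_distrib, ← Finset.mul_sum, Finset.card_filter]
        simp
      rw [h4, if_pos hk]
      have h6 : (((Finset.univ.filter fun x : Fin (2 ^ (a + p)) =>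
        (x + t k) % 2 ^ a = b).card : ℕ) : ℝ) ≤ 2 ^ p := by exact_mod_cast h3
      push_cast
      calc _ ≤ (2 : ℝ) ^ (a + p) + 3 * 2 ^ p := by linarith
        _ = 2 ^ (a + p) * (3 / 2 ^ a + 1) := by field_simp; ring
        _ ≤ _ := by gcongr; exact Real.add_one_le_exp _
    · simp [g, hk]
  have h3 : ((∏ k, ∑ x, g k x : ℕ) : ℝ) ≤
      (2 ^ (a + p)) ^ Fintype.card ι * Real.exp (3 / 2 ^ a) ^ S.card := by
    push_cast
    refine (Finset.prod_le_prod (fun k _ => by positivity) fun k _ => by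
      exact_mod_cast h2 k).trans_eq ?_
    rw [Finset.prod_mul_distrib, Finset.prod_const, Finset.card_univ, Finset.prod_ite,
      Finset.prod_const_one, mul_one, Finset.filter_mem_eq_inter, Finset.univ_inter,
      Finset.prod_const]
    push_cast
    rfl
  have h4 : Real.exp (3 / 2 ^ a) ^ S.card ≤ 2 ^ h := by
    have h0 : (2 : ℝ) ^ h = Real.exp (h * Real.log 2) := by
      rw [Real.exp_nat_mul, Real.exp_log (by norm_num)]
    rw [← Real.exp_nat_mul, h0, Real.exp_le_exp]
    have h5 : (8 : ℝ) * S.card ≤ h * 2 ^ a := by exact_mod_cast (by omega : 8 * S.card ≤ h * 2 ^ a)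
    have h6 := Real.log_two_gt_d9
    have h7 : (S.card : ℝ) * (3 / 2 ^ a) ≤ h * (3 / 8) := by
      rw [← mul_div_assoc, div_le_iff₀ (by positivity)]
      linarith
    have h8 : (0 : ℝ) ≤ h := by positivity
    nlinarith
  have h5 : ((B.card * 2 ^ h * 2 ^ h : ℕ) : ℝ) ≤
      (((2 ^ (a + p)) ^ Fintype.card ι * 2 ^ h : ℕ) : ℝ) := by
    calc ((B.card * 2 ^ h * 2 ^ h : ℕ) : ℝ) = ((B.card * 4 ^ h : ℕ) : ℝ) := by
          rw [mul_assoc, ← mul_pow]; norm_num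
      _ ≤ ((∏ k, ∑ x, g k x : ℕ) : ℝ) := by exact_mod_cast h1
      _ ≤ _ := h3
      _ ≤ _ := by
        push_cast
        gcongr
  exact Nat.le_of_mul_le_mul_right (by exact_mod_cast h5) (show 0 < 2 ^ h by positivity)

/-- With several blocks, the random bits are lucky with high probability. -/
theorem card_not_lucky_le {n : ℕ} (G : SimpleGraph (Fin n)) [DecidableRel G.Adj] (τ : Fin n → ℕ)
    {P : Params} (hs : P.small = false) (hp : P.positions = 16 * P.period)
    (hd : 8 * G.maxDegree ≤ P.period * 2 ^ P.shiftBits) (hn : 2 ^ P.shiftBits ≤ 16 * n) {c : ℕ}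
    (hc : 17 * n ^ 2 * n ^ c ≤ 2 ^ P.period) {idx : Fin n → ι} (hidx : Function.Injective idx) :
    Set.ncard {ω : ι → Fin (2 ^ P.coins) | ¬ Lucky G τ P fun v => ω (idx v)} * n ^ c ≤ (2 ^ P.coins) ^ Fintype.card ι := by
  classical
  obtain ⟨w, a, p, h, small⟩ := P
  simp only at hs hp hd hn hc
  subst hs hp
  set P : Params := ⟨w, a, 16 * h, h, false⟩ with hP
  let m := 2 ^ (a + 16 * h)
  let B₁ : Fin n × Fin n → Finset (ι → Fin m) := fun z => Finset.univ.filter fun ω =>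
    z.1 ≠ z.2 ∧ ((Finset.range (16 * h)).filter fun q =>
      digit 1 (ω (idx z.1)) (a + q) = 0 ∧ digit 1 (ω (idx z.2)) (a + q) = 1).card ≤ 2 * h
  let B₂ : Fin n × ℕ → Finset (ι → Fin m) := fun z => Finset.univ.filter fun ω =>
    h < (Finset.univ.filter fun u => G.Adj u z.1 ∧ τ u < τ z.1 ∧
      edgeBlock G τ P (fun v => ω (idx v)) u z.1 = z.2).card
  have h1 : ∀ z, (B₁ z).card * 2 ^ h ≤ m ^ Fintype.card ι := by
    rintro ⟨u, v⟩
    rcases eq_or_ne u v with rfl | huv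
    · simp [B₁]
    · have e1 := card_pair_mul (m := m) (hidx.ne huv) fun x y =>
        ((Finset.range (16 * h)).filter fun q =>
          digit 1 x (a + q) = 0 ∧ digit 1 y (a + q) = 1).card ≤ 2 * h
      have e2 := card_few_positions a h
      have e3 : (B₁ (u, v)).card = (Finset.univ.filter fun ω : ι → Fin m =>
          ((Finset.range (16 * h)).filter fun q => digit 1 (ω (idx u)) (a + q) = 0 ∧
            digit 1 (ω (idx v)) (a + q) = 1).card ≤ 2 * h).card := by
        simp only [B₁, ne_eq, huv, not_false_eq_true, true_and]
      rw [← e3] at e1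
      have hm : 0 < m := by positivity
      refine Nat.le_of_mul_le_mul_right ?_ (Nat.mul_pos hm hm)
      calc (B₁ (u, v)).card * 2 ^ h * (m * m) = (B₁ (u, v)).card * (m * m) * 2 ^ h := by ring
        _ ≤ m ^ Fintype.card ι * (m * m) := by
          rw [e1, mul_right_comm, mul_comm (m ^ Fintype.card ι)]
          exact Nat.mul_le_mul_right _ e2
  have h2 : ∀ z, (B₂ z).card * 2 ^ h ≤ m ^ Fintype.card ι := by
    rintro ⟨v, b⟩
    -- The chosen blocks depend on the random bits only through the shifts.
    let T := Finset.univ.filter fun u => G.Adj u v ∧ τ u < τ v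
    let t : ι → ℕ := Function.extend idx (fun u => laterCount G τ u (τ v) / h) 0
    have hT : (T.map ⟨idx, hidx⟩).card ≤ G.maxDegree := by
      rw [Finset.card_map]
      refine le_trans (Finset.card_le_card fun u hu => ?_) (G.degree_le_maxDegree v)
      simp only [T, Finset.mem_filter, Finset.mem_univ, true_and] at hu
      simpa using hu.1.symm
    have e1 := card_overload_le a (16 * h) hd _ hT t b
    have e2 : (B₂ (v, b)) = Finset.univ.filter fun ω : ι → Fin m =>
        h < ((T.map ⟨idx, hidx⟩).filter fun k => (ω k + t k) % 2 ^ a = b).card := by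
      refine Finset.filter_congr fun ω _ => ?_
      rw [Finset.filter_map, Finset.card_map, Finset.filter_filter]
      simp only [Function.comp_def, Function.Embedding.coeFn_mk, t, hidx.extend_apply, edgeBlock,
        Params.block, hP, and_assoc]
    rw [e2]
    exact e1
  have h3 : (Finset.univ.filter fun ω : ι → Fin m => ¬ Lucky G τ P fun v => ω (idx v)) ⊆
      Finset.univ.biUnion B₁ ∪ (Finset.univ ×ˢ Finset.range (2 ^ a)).biUnion B₂ := by
    intro ω hω
    by_contra hno
    simp only [Finset.mem_union, Finset.mem_biUnion, not_or, not_exists, not_and] at hno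
    simp only [Finset.mem_filter, Finset.mem_univ, true_and] at hω
    refine hω (.inr ⟨rfl, fun u v huv => ?_, fun v b => ?_⟩)
    · have := hno.1 (u, v) (Finset.mem_univ _)
      simp only [B₁, Finset.mem_filter, Finset.mem_univ, true_and, not_and, not_le] at this
      exact this huv
    · by_cases hb : b < 2 ^ a
      · have := hno.2 (v, b) (by simpa using hb)
        simp only [B₂, Finset.mem_filter, Finset.mem_univ, true_and, not_lt] at this
        exact this
      · rw [Finset.filter_eq_empty_iff.2]
        · exact Nat.zero_le _
        · rintro u - ⟨-, -, rfl⟩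
          exact hb (P.block_lt _ _)
  have h4 := (Finset.card_le_card h3).trans ((Finset.card_union_le _ _).trans
    (Nat.add_le_add Finset.card_biUnion_le Finset.card_biUnion_le))
  have h5 : (∑ z, (B₁ z).card + ∑ z ∈ Finset.univ ×ˢ Finset.range (2 ^ a), (B₂ z).card) * 2 ^ h ≤
      17 * n ^ 2 * m ^ Fintype.card ι := by
    rw [add_mul, Finset.sum_mul, Finset.sum_mul]
    refine (Nat.add_le_add (Finset.sum_le_sum fun z _ => h1 z)
      (Finset.sum_le_sum fun z _ => h2 z)).trans ?_
    simp only [Finset.sum_const, Finset.card_product, Finset.card_univ, Finset.card_range,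
      Fintype.card_prod, Fintype.card_fin, smul_eq_mul]
    rw [← add_mul]
    refine Nat.mul_le_mul_right _ ?_
    nlinarith
  refine Nat.le_of_mul_le_mul_right (?_ : _ ≤ _ * 2 ^ h) (show 0 < 2 ^ h by positivity)
  have h6 := calc (Finset.univ.filter fun ω : ι → Fin m =>
        ¬ Lucky G τ P fun v => ω (idx v)).card * n ^ c * 2 ^ h
      ≤ (∑ z, (B₁ z).card + ∑ z ∈ Finset.univ ×ˢ Finset.range (2 ^ a), (B₂ z).card) *
        n ^ c * 2 ^ h := Nat.mul_le_mul_right _ (Nat.mul_le_mul_right _ h4)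
    _ = (∑ z, (B₁ z).card + ∑ z ∈ Finset.univ ×ˢ Finset.range (2 ^ a), (B₂ z).card) * 2 ^ h *
        n ^ c := by ring
    _ ≤ 17 * n ^ 2 * m ^ Fintype.card ι * n ^ c := Nat.mul_le_mul_right _ h5
    _ = m ^ Fintype.card ι * (17 * n ^ 2 * n ^ c) := by ring
    _ ≤ _ := Nat.mul_le_mul_left _ hc
  have h7 : Set.ncard {ω : ι → Fin m | ¬ Lucky G τ P fun v => ω (idx v)} =
      (Finset.univ.filter fun ω : ι → Fin m => ¬ Lucky G τ P fun v => ω (idx v)).card := by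
    rw [← Set.ncard_coe_finset]
    simp
  rw [← h7] at h6
  exact h6

end Counting

/-! ### The algorithm on vertex-arrival streams -/

section Streams

variable {n : ℕ} (π : Equiv.Perm (Fin n)) (back : Fin n → List (Fin n))

theorem arrive_mem_vertexStream (v : Fin n) : Token.arrive v ∈ vertexStream π back := by
  simp only [vertexStream, List.mem_append, List.mem_flatten, List.mem_ofFn]
  exact .inl ⟨_, ⟨π.symm v, rfl⟩, by simp⟩

/-- Every vertex arrives only once. -/
theorem pairwise_vertexStream :
    (vertexStream π back).Pairwise fun t t' => ∀ v, t = Token.arrive v → t' ≠ Token.arrive v := by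
  rw [vertexStream, List.pairwise_append, List.pairwise_flatten, List.pairwise_ofFn]
  refine ⟨⟨fun l hl => ?_, fun i j hij t ht t' ht' v => ?_⟩, by simp, by simp⟩
  · obtain ⟨i, rfl⟩ := List.mem_ofFn.1 hl
    rw [List.pairwise_cons, List.pairwise_map]
    exact ⟨by simp, List.pairwise_of_forall (by simp)⟩
  · simp only [List.mem_cons, List.mem_map] at ht ht'
    rintro rfl rfl
    simp only [Token.arrive.injEq, reduceCtorEq, and_false, exists_false, or_false] at ht ht'
    exact hij.ne (π.injective (ht.symm.trans ht'))

theorem get_injective_arrive {i j : Fin (vertexStream π back).length} {v : Fin n}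
    (hi : (vertexStream π back).get i = Token.arrive v)
    (hj : (vertexStream π back).get j = Token.arrive v) : i = j := by
  have h := List.pairwise_iff_get.1 (pairwise_vertexStream π back)
  rcases lt_trichotomy i j with h1 | h1 | h1
  · exact absurd hj (h _ _ h1 v hi)
  · exact h1
  · exact absurd hi (h _ _ h1 v hj)

end Streams

theorem lucky_of_small {c n : ℕ} {G : SimpleGraph (Fin n)} [DecidableRel G.Adj]
    (h : G.maxDegree < threshold c n) (τ ρ : Fin n → ℕ) :
    Lucky G τ (params c n G.maxDegree) ρ := by
  refine .inl ?_
  rw [params, if_pos h]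
  refine ⟨rfl, ?_, ?_⟩ <;> simp only <;> omega

theorem fits_params {c n : ℕ} (hn : 1 ≤ n) {G : SimpleGraph (Fin n)} [DecidableRel G.Adj]
    (hG : G.maxDegree ≤ n) {ρ : Fin n → ℕ} (hρ : ∀ v, ρ v < 2 ^ (params c n G.maxDegree).coins) :
    Fits G (params c n G.maxDegree) ρ where
  coin_lt v := (hρ v).trans_le (Nat.pow_le_pow_right (by omega) (by rw [params_cell]; omega))
  degree_lt := (hG.trans_lt (Nat.lt_size_self n)).trans_le
    (Nat.pow_le_pow_right (by omega) (by rw [params_cell]; omega))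
  positions_le := by rw [params_cell, Params.coins]; omega
  period_pos := params_period_pos hn
  blocks := params_div_period_lt c n _

/-- The choice of the threshold lets the union bound succeed. -/
theorem threshold_spec {c n : ℕ} (hn : 1 ≤ n) : 17 * n ^ 2 * n ^ c ≤ 2 ^ threshold c n := by
  have h0 := Nat.size_pos.2 hn
  have h1 := (Nat.lt_size_self n).le
  calc 17 * n ^ 2 * n ^ c ≤ 2 ^ (5 * n.size) * (2 ^ n.size) ^ 2 * (2 ^ n.size) ^ c := by
        gcongr
        calc 17 ≤ 2 ^ 5 := by norm_num
          _ ≤ _ := Nat.pow_le_pow_right (by omega) (by omega)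
    _ = _ := by rw [threshold]; ring

/-- The random bits that are drawn at the arrivals are lucky with high probability. -/
theorem ncard_not_lucky_le {c n : ℕ} (hn : 1 ≤ n) {G : SimpleGraph (Fin n)} [DecidableRel G.Adj]
    (hG : G.maxDegree ≤ n) (τ : Fin n → ℕ) {ι : Type} [Fintype ι] [DecidableEq ι]
    {idx : Fin n → ι} (hidx : Function.Injective idx) :
    Set.ncard {ω : ι → Fin (2 ^ (params c n G.maxDegree).coins) |
      ¬ Lucky G τ (params c n G.maxDegree) fun v => ω (idx v)} * n ^ c ≤
      (2 ^ (params c n G.maxDegree).coins) ^ Fintype.card ι := by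
  by_cases h : G.maxDegree < threshold c n
  · have h1 : {ω : ι → Fin (2 ^ (params c n G.maxDegree).coins) |
        ¬ Lucky G τ (params c n G.maxDegree) fun v => ω (idx v)} = ∅ :=
      Set.eq_empty_of_forall_notMem fun ω hω => hω (lucky_of_small h τ _)
    rw [h1, Set.ncard_empty, zero_mul]
    exact Nat.zero_le _
  · have ht := threshold_pos c hn
    have h2 := params_colors_le (c := c) hn (show 1 ≤ G.maxDegree by omega)
    refine card_not_lucky_le G τ ?_ ?_ ?_ ?_ ?_ hidx
    · rw [params, if_neg h]
    · rw [params, if_neg h]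
    · rw [params, if_neg h]
      simp only [pow_add]
      have h3 := Nat.lt_size_self (G.maxDegree / threshold c n)
      have h4 := Nat.lt_mul_div_succ G.maxDegree ht
      have h5 : threshold c n * (G.maxDegree / threshold c n + 1) ≤
        threshold c n * 2 ^ (G.maxDegree / threshold c n).size := Nat.mul_le_mul_left _ h3
      rw [← mul_assoc]
      omega
    · have h3 : 16 ≤ (params c n G.maxDegree).positions := by
        rw [params, if_neg h]
        simp only
        omega
      have h4 : 2 ^ (params c n G.maxDegree).shiftBits * 16 ≤ 256 * n :=
        (Nat.mul_le_mul_left _ h3).trans (h2.trans (Nat.mul_le_mul_left _ hG))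
      omega
    · have h3 : (params c n G.maxDegree).period = threshold c n := by rw [params, if_neg h]
      rw [h3]
      exact threshold_spec hn

end WStream

/-- For every exponent `c` there are a randomized streaming algorithm `A` and constants `C`, `k` such
that on every `n`-vertex graph `G` of maximum degree `Δ` and every vertex-arrival stream of `G`,
`A` uses at most `S = C * n * (size n) ^ k` bits of space, whatever its coin tosses are
(`Nat.size n` is the number of binary digits of `n`), and reports a proper edge coloring of `G` with
`C * Δ` colors with probability at least `1 - 1 / n ^ c`. -/
theorem theorem3 (c : ℕ) :
    ∃ (A : WStream.Algorithm) (C k : ℕ),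
      ∀ (n : ℕ), 1 ≤ n →
      ∀ (G : SimpleGraph (Fin n)) [DecidableRel G.Adj]
        (π : Equiv.Perm (Fin n)) (back : Fin n → List (Fin n)),
        WStream.IsBackLists G π back →
        ∃ R : ℕ,
          WStream.evalSpace (C * n * Nat.size n ^ k) A.coins (Nat.pair n G.maxDegree) = some R ∧
          (∀ ω : Fin (WStream.vertexStream π back).length → Fin (2 ^ R),
            (A.run (C * n * Nat.size n ^ k) G.maxDegree
              (WStream.vertexStream π back) ω).isSome) ∧
          1 - 1 / (n : ℝ) ^ c ≤
            A.successProb (C * n * Nat.size n ^ k) G.maxDegree (C * G.maxDegree) G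
              (WStream.vertexStream π back) R := by
  obtain ⟨A, C, hA⟩ := WStream.exists_algorithm c
  refine ⟨A, C + 256, 1, fun n hn G _ π back hback => ?_⟩
  obtain ⟨hcoins, hproc⟩ := hA (C + 256) (by omega)
  have hG : G.maxDegree ≤ n := G.maxDegree_le_of_forall_degree_le n fun v => by
    simpa using (G.degree_lt_card_verts v).le
  set S := (C + 256) * n * Nat.size n ^ 1 with hS
  have hS' : S = (C + 256) * (n * n.size) := by rw [hS, pow_one, mul_assoc]
  set P := WStream.params c n G.maxDegree with hP
  let Z : (Fin (WStream.vertexStream π back).length → Fin (2 ^ P.coins)) →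
      List (WStream.Token n × ℕ) :=
    fun ω => List.ofFn fun i => ((WStream.vertexStream π back).get i, (ω i : ℕ))
  have hrun : ∀ ω, A.run S G.maxDegree (WStream.vertexStream π back) ω =
      some (WStream.records P ⟨0, 0, 0, 0, 0⟩ (Z ω)) := by
    intro ω
    have h := WStream.exec_eq (c := c) (S := S) (A := A) hn hG
      (fun i hi => by rw [hS', ← hi]; exact hproc i) (Z ω) (fun z hz => by
        obtain ⟨i, rfl⟩ := List.mem_ofFn.1 hz
        exact (ω i).2) ⟨0, 0, 0, 0, 0⟩
      ⟨by simp only; omega, by positivity, by positivity, by positivity, by positivity⟩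
    rw [← hP, List.map_ofFn] at h
    exact h
  refine ⟨P.coins, by rw [hS']; exact hcoins n _ hn hG, fun ω => by rw [hrun]; rfl, ?_⟩
  have hidx : ∀ v, ∃ i, (WStream.vertexStream π back).get i = WStream.Token.arrive v := fun v =>
    List.mem_iff_get.1 (WStream.arrive_mem_vertexStream π back v)
  choose idx hidx using hidx
  have hinj : Function.Injective idx := fun v w h => by
    have := (hidx v).symm.trans ((congrArg _ h).trans (hidx w))
    simpa using this
  have hsub : {ω : Fin (WStream.vertexStream π back).length → Fin (2 ^ P.coins) |
        WStream.Lucky G (fun v => (π.symm v : ℕ)) P fun v => ω (idx v)} ⊆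
      {ω | ∃ L, A.run S G.maxDegree (WStream.vertexStream π back) ω = some L ∧
        WStream.ReportsEdgeColoring G ((C + 256) * G.maxDegree) L} := by
    intro ω hω
    refine ⟨_, hrun ω, WStream.reports_records hback
      (WStream.fits_params hn hG fun v => (ω (idx v)).2) hω (fun hpos => ?_) _ ?_ ?_⟩
    · exact (WStream.params_colors_le hn hpos).trans (Nat.mul_le_mul_right _ (by omega))
    · rw [List.map_ofFn]
      exact List.ofFn_get _
    · intro v r hr
      obtain ⟨i, hi⟩ := List.mem_ofFn.1 hr
      simp only [Prod.mk.injEq] at hi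
      rw [← hi.2, WStream.get_injective_arrive π back hi.1 (hidx v)]
  have h1 := Set.ncard_le_ncard hsub (Set.toFinite _)
  have h2 := Set.ncard_add_ncard_compl
    {ω : Fin (WStream.vertexStream π back).length → Fin (2 ^ P.coins) |
      WStream.Lucky G (fun v => (π.symm v : ℕ)) P fun v => ω (idx v)}
  have h3 := WStream.ncard_not_lucky_le (c := c) hn hG (fun v => (π.symm v : ℕ)) hinj
  rw [Nat.card_eq_fintype_card, Set.compl_ofPred] at h2
  rw [WStream.Algorithm.successProb]
  set N := Fintype.card (Fin (WStream.vertexStream π back).length → Fin (2 ^ P.coins)) with hN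
  have hN0 : 0 < N := Fintype.card_pos
  have hN' : (2 ^ P.coins) ^ Fintype.card (Fin (WStream.vertexStream π back).length) = N := by
    rw [hN]; simp
  rw [← hP, hN'] at h3
  rw [le_div_iff₀ (by exact_mod_cast hN0)]
  have hn0 : (0 : ℝ) < (n : ℝ) ^ c := by positivity
  have h1' : (_ : ℝ) ≤ _ := Nat.cast_le.2 h1
  have h2' : ((_ : ℕ) : ℝ) = _ := congrArg Nat.cast h2
  have h3' : ((_ : ℕ) : ℝ) ≤ _ := Nat.cast_le.2 h3
  push_cast at h2' h3'
  rw [← le_div_iff₀ hn0] at h3'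
  rw [sub_mul, one_mul, one_div_mul_eq_div]
  linarith
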